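/- Let $(K,|\cdot|)$ be an algebraically closed field which is complete with respect to an absolute value (archimedean or non-archimedean), let $M$ be a lattice of finite rank $n$, $N$ its dual lattice, $N_{\mathbb R}=\operatorname{Hom}(M,\mathbb R)$ and $M_{\mathbb R}=\mathbb R\otimes M$, with pairing $\langle\cdot,\cdot\rangle$. Let $\mathbb T=\operatorname{Spec}K[M]$ and let $\mathbb T^{\mathrm{an}}$ be its Berkovich analytification, i.e. the set of multiplicative seminorms $\|\cdot\|_x$ on $K[M]$ extending $|\cdot|$, with the coarsest topology making all the maps $x\mapsto\|g\|_x$, $g\in K[M]$, continuous. Let $\operatorname{trop}:\mathbb T^{\mathrm{an}}\to N_{\mathbb R}$ be given by $\operatorname{trop}(x)(m)=-\log\|\chi^m\|_x$. For $u\in N_{\mathbb R}$ let $\sigma_u$ be the following probability measure on $\operatorname{trop}^{-1}(u)$: if $K$ is archimedean, so that $K=\mathbb C$ with a power of the usual absolute value and $\operatorname{trop}^{-1}(u)$ is a torsor under the compact torus $(\mathbb S^1)^n$, it is the normalized Haar measure of $\operatorname{trop}^{-1}(u)$; if $K$ is non-archimedean, it is the Dirac measure at the Gauss point $\sum_m c_m\chi^m\mapsto\max_m|c_m|e^{-\langle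 m,u\rangle}$. Let $f=\sum_m c_m\chi^m\in K[M]$ be a nonzero Laurent polynomial. Its amoeba is $\mathcal A_f=\operatorname{trop}(V(f)^{\mathrm{an}})$, where $V(f)^{\mathrm{an}}=\{x\in\mathbb T^{\mathrm{an}}:\|f\|_x=0\}$; its Newton polytope $\operatorname{NP}(f)\subset M_{\mathbb R}$ is the convex hull of $\{m: c_m\neq0\}$, with support function $\Psi_{\operatorname{NP}(f)}(u)=\min_{x\in\operatorname{NP}(f)}\langle x,u\rangle$; and its Ronkin function is $$\rho_f(u)=\int_{\operatorname{trop}^{-1}(u)}-\log\|f\|_x\,d\sigma_u(x),\qquad u\in N_{\mathbb R}.$$ Then for every $u\in N_{\mathbb R}$ one has $\|f\|_x\neq0$ for $\sigma_u$-almost every $x$ and the above integral is absolutely convergent, so that $\rho_f:N_{\mathbb R}\to\mathbb R$ is well defined, and: 1. $\rho_f$ is a continuous (in particular upper semicontinuous) concave function on $N_{\mathbb R}$, and it is affine on each connected component of $N_{\mathbb R}\setminus\mathcal A_f$. 2. $|\rho_f-\Psi_{\operatorname{NP}(f)}|$ is bounded on $N_{\mathbb R}$. 3. The stability set of $\rho_f$,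 i.e. the set of $x\in M_{\mathbb R}$ with $\inf_{u\in N_{\mathbb R}}(\langle x,u\rangle-\rho_f(u))>-\infty$, equals $\operatorname{NP}(f)$; and the recession function of $\rho_f$ is $\Psi_{\operatorname{NP}(f)}$, i.e. $\lim_{\lambda\to+\infty}\rho_f(v_0+\lambda u)/\lambda=\Psi_{\operatorname{NP}(f)}(u)$ for all $v_0,u\in N_{\mathbb R}$. -/

import Mathlib

open scoped TensorProduct NNReal
open MeasureTheory Filter Topology

namespace Ronkin
noncomputable section

/-! ### Archimedean algebraically closed complete fields -/

theorem exists_rpow_of_archimedean {K : Type*} [NormedField K] (h : ¬ IsUltrametricDist K) :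
    ∃ s : ℝ, 0 < s ∧ ∀ q : ℚ, ‖(q : K)‖ = |(q : ℝ)| ^ s := by
  have h1 : ¬ ∀ n : ℕ, ‖(n : K)‖ ≤ 1 := fun h' =>
    h (IsUltrametricDist.isUltrametricDist_of_forall_norm_natCast_le_one h')
  have h0 : CharZero K := by
    obtain ⟨p, hp⟩ := CharP.exists K
    rcases Nat.eq_zero_or_pos p with rfl | hp0
    · exact CharP.charP_to_charZero K
    · exfalso
      apply h1
      intro n
      have hpp : p.Prime := (CharP.char_is_prime_or_zero K p).resolve_right hp0.ne'
      have : Fact p.Prime := ⟨hpp⟩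
      have e : ((n : K)) ^ p = n := by
        have := congrArg (ZMod.castHom dvd_rfl K) (ZMod.pow_card ((n : ZMod p)))
        rwa [map_pow, map_natCast] at this
      have e' := congrArg norm e
      rw [norm_pow] at e'
      by_contra hlt
      push Not at hlt
      have := lt_self_pow₀ hlt hpp.one_lt
      linarith
  let f : AbsoluteValue ℚ ℝ :=
    { toFun := fun q => ‖(q : K)‖
      map_mul' := by intro x y; simp
      nonneg' := fun _ => norm_nonneg _
      eq_zero' := by intro x; simp
      add_le' := by intro x y; push_cast; exact norm_add_le _ _ }
  have hf : ¬ ∀ n : ℕ, f n ≤ 1 := by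
    intro h'; apply h1; intro n; simpa [f] using h' n
  obtain ⟨c, hc, hcf⟩ := AbsoluteValue.isEquiv_iff_exists_rpow_eq.1
    (Rat.AbsoluteValue.equiv_real_of_unbounded hf).symm
  refine ⟨c, hc, fun q => ?_⟩
  have := congrFun hcf q
  simpa [f] using this.symm

theorem add_rpow_le_of_archimedean {K : Type*} [NormedField K] {s : ℝ} (hs : 0 < s)
    (h : ∀ q : ℚ, ‖(q : K)‖ = |(q : ℝ)| ^ s) (x y : K) :
    ‖x + y‖ ^ s⁻¹ ≤ ‖x‖ ^ s⁻¹ + ‖y‖ ^ s⁻¹ := by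
  set a := ‖x‖ ^ s⁻¹ with ha
  set b := ‖y‖ ^ s⁻¹ with hb
  have ha0 : 0 ≤ a := by positivity
  have hb0 : 0 ≤ b := by positivity
  have hx : ‖x‖ = a ^ s := by rw [ha, Real.rpow_inv_rpow (norm_nonneg _) hs.ne']
  have hy : ‖y‖ = b ^ s := by rw [hb, Real.rpow_inv_rpow (norm_nonneg _) hs.ne']
  rw [Real.rpow_inv_le_iff_of_pos (norm_nonneg _) (by positivity) hs]
  have key : ∀ n : ℕ, ‖x + y‖ ^ n ≤ (n + 1) * ((a + b) ^ s) ^ n := by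
    intro n
    rw [← norm_pow, add_pow]
    refine (norm_sum_le _ _).trans ?_
    have : ∀ k ∈ Finset.range (n + 1), ‖x ^ k * y ^ (n - k) * (n.choose k : K)‖
        ≤ ((a + b) ^ s) ^ n := by
      intro k hk
      have hc : ‖(n.choose k : K)‖ = (n.choose k : ℝ) ^ s := by
        have := h (n.choose k)
        simpa using this
      have hp : ∀ (r : ℝ) (j : ℕ), 0 ≤ r → (r ^ s) ^ j = (r ^ j) ^ s := by
        intro r j hr
        rw [← Real.rpow_natCast, ← Real.rpow_natCast, ← Real.rpow_mul hr, ← Real.rpow_mul hr,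
          mul_comm]
      rw [norm_mul, norm_mul, norm_pow, norm_pow, hx, hy, hc, hp _ _ ha0, hp _ _ hb0,
        hp _ _ (by positivity), ← Real.mul_rpow (by positivity) (by positivity),
        ← Real.mul_rpow (by positivity) (by positivity)]
      refine Real.rpow_le_rpow (by positivity) ?_ hs.le
      rw [add_pow]
      exact Finset.single_le_sum (f := fun k => a ^ k * b ^ (n - k) * (n.choose k : ℝ))
        (fun i _ => by positivity) hk
    refine (Finset.sum_le_sum this).trans ?_
    simp
  have hA : 0 ≤ (a + b) ^ s := by positivity
  by_contra hlt
  push Not at hlt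
  rcases hA.eq_or_lt with h0 | h0
  · have := key 1
    rw [← h0] at this hlt
    simp at this
    rw [this] at hlt
    simp at hlt
  · have hr : 1 < ‖x + y‖ / (a + b) ^ s := (one_lt_div h0).2 hlt
    obtain ⟨n, hn⟩ := ((tendsto_pow_const_div_const_pow_of_one_lt 1 hr).eventually
      (gt_mem_nhds (show (0 : ℝ) < 1 / 2 by norm_num)) |>.and (eventually_ge_atTop 1)).exists
    have hk := key n
    have h3 : (‖x + y‖ / (a + b) ^ s) ^ n ≤ n + 1 := by
      rw [div_pow, div_le_iff₀ (by positivity)]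
      exact hk
    have h4 : 0 < (‖x + y‖ / (a + b) ^ s) ^ n := by positivity
    rw [div_lt_iff₀ h4, pow_one] at hn
    have : (1 : ℝ) ≤ n := by exact_mod_cast hn.2
    nlinarith [hn.1]

theorem exists_complex_ringEquiv {K : Type*} [NormedField K] [CompleteSpace K] [IsAlgClosed K]
    (h : ¬ IsUltrametricDist K) :
    ∃ (s : ℝ) (e : ℂ ≃+* K), 0 < s ∧ ∀ z, ‖e z‖ = ‖z‖ ^ s := by
  obtain ⟨s, hs, hq⟩ := exists_rpow_of_archimedean h
  have h0 : CharZero K := by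
    refine charZero_of_inj_zero fun n hn => ?_
    have := hq n
    by_contra hn0
    simp [hn] at this
    have h2 : (0 : ℝ) < (n : ℝ) ^ s := by positivity
    linarith
  -- the embedding of the reals
  have huc : UniformContinuous (Rat.castHom K) := by
    refine uniformContinuous_of_continuousAt_zero (Rat.castHom K).toAddMonoidHom ?_
    rw [ContinuousAt, tendsto_iff_norm_sub_tendsto_zero]
    have : Tendsto (fun q : ℚ => |(q : ℝ)| ^ s) (𝓝 0) (𝓝 0) := by
      have hc : Continuous fun q : ℚ => |(q : ℝ)| ^ s :=
        (Rat.continuous_coe_real.abs).rpow_const fun _ => Or.inr hs.le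
      have := hc.tendsto 0
      simpa [Real.zero_rpow hs.ne'] using this
    refine this.congr fun q => ?_
    simp [hq]
  have hui : IsUniformInducing (Rat.castHom ℝ) := Rat.isUniformEmbedding_coe_real.isUniformInducing
  have hdr : DenseRange (Rat.castHom ℝ) := Rat.isDenseEmbedding_coe_real.dense
  let ι : ℝ →+* K := IsDenseInducing.extendRingHom hui hdr huc
  have hιc : Continuous ι := (uniformContinuous_uniformly_extend hui hdr huc).continuous
  have hιn : ∀ r : ℝ, ‖ι r‖ = |r| ^ s := by
    intro r
    refine hdr.induction_on (p := fun r => ‖ι r‖ = |r| ^ s) r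
      (isClosed_eq hιc.norm (continuous_abs.rpow_const fun _ => Or.inr hs.le)) fun q => ?_
    have : ι (q : ℝ) = (q : K) := map_ratCast ι q
    simpa [this] using hq q
  -- the renormalised absolute value
  let w : AbsoluteValue K ℝ :=
    { toFun := fun x => ‖x‖ ^ s⁻¹
      map_mul' := by intro x y; rw [norm_mul, Real.mul_rpow (norm_nonneg _) (norm_nonneg _)]
      nonneg' := fun _ => by positivity
      eq_zero' := by
        intro x
        rw [Real.rpow_eq_zero (norm_nonneg _) (inv_ne_zero hs.ne'), norm_eq_zero]
      add_le' := add_rpow_le_of_archimedean hs hq }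
  have hw : ∀ x : WithAbs w, ‖x‖ = ‖x.ofAbs‖ ^ s⁻¹ := fun x => rfl
  let j : ℝ →+* WithAbs w := (WithAbs.equiv w).symm.toRingHom.comp ι
  have hj : ∀ r, ‖j r‖ = |r| := by
    intro r
    rw [hw]
    change ‖ι r‖ ^ s⁻¹ = _
    rw [hιn, Real.rpow_rpow_inv (abs_nonneg _) hs.ne']
  let _ : Algebra ℝ (WithAbs w) := j.toAlgebra
  let _ : NormedAlgebra ℝ (WithAbs w) :=
    { norm_smul_le := fun r x => by
        rw [Algebra.smul_def, norm_mul]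
        exact le_of_eq (by rw [show ‖algebraMap ℝ (WithAbs w) r‖ = ‖r‖ from hj r]) }
  have hac : IsAlgClosed (WithAbs w) := IsAlgClosed.of_ringEquiv K (WithAbs w) (WithAbs.equiv w).symm
  have e₀ : Nonempty (WithAbs w ≃ₐ[ℝ] ℂ) := by
    refine (NormedAlgebra.Real.nonempty_algEquiv_or (WithAbs w)).resolve_left ?_
    rintro ⟨e⟩
    obtain ⟨x, hx⟩ := IsAlgClosed.exists_pow_nat_eq (-1 : WithAbs w) (n := 2) (by norm_num)
    have hx' := congrArg e hx
    rw [map_pow, map_neg, map_one] at hx'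
    nlinarith [sq_nonneg (e x)]
  obtain ⟨e⟩ := e₀
  have hcont : Continuous e.symm.toLinearMap := LinearMap.continuous_of_finiteDimensional _
  let T : ℂ →L[ℝ] WithAbs w := ⟨e.symm.toLinearMap, hcont⟩
  have hT : ∀ z, ‖e.symm z‖ ≤ ‖T‖ * ‖z‖ := T.le_opNorm
  have hle : ∀ z, ‖e.symm z‖ ≤ ‖z‖ := by
    intro z
    by_contra hlt
    push Not at hlt
    rcases (norm_nonneg z).eq_or_lt with hz | hz
    · have : z = 0 := norm_eq_zero.1 hz.symm
      simp [this] at hlt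
    have hr : 1 < ‖e.symm z‖ / ‖z‖ := (one_lt_div hz).2 hlt
    obtain ⟨n, hn⟩ := pow_unbounded_of_one_lt ‖T‖ hr
    have := hT (z ^ n)
    rw [map_pow, norm_pow, norm_pow, ← div_le_iff₀ (by positivity), ← div_pow] at this
    linarith
  have heq : ∀ z, ‖e.symm z‖ = ‖z‖ := by
    intro z
    rcases eq_or_ne z 0 with rfl | hz
    · simp
    refine le_antisymm (hle z) ?_
    have := hle z⁻¹
    rw [map_inv₀, norm_inv, norm_inv] at this
    have hz' : 0 < ‖e.symm z‖ := norm_pos_iff.2 (by simpa using hz)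
    exact (inv_le_inv₀ hz' (norm_pos_iff.2 hz)).1 this
  refine ⟨s, e.symm.toRingEquiv.trans (WithAbs.equiv w), hs, fun z => ?_⟩
  have := heq z
  rw [hw] at this
  rw [← this, Real.rpow_inv_rpow (norm_nonneg _) hs.ne']
  rfl

/-! ### Lattices -/

/-- The real vector space `N_ℝ = Hom(M, ℝ)` attached to the dual `N` of a lattice `M`. -/
def NR (M : Type*) [AddCommGroup M] : Type _ := M →+ ℝ

/-- The real vector space `M_ℝ = ℝ ⊗ M`. -/
abbrev MR (M : Type*) [AddCommGroup M] : Type _ := ℝ ⊗[ℤ] M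

section Lattice

variable {M : Type*} [AddCommGroup M]

instance : AddCommGroup (NR M) := inferInstanceAs (AddCommGroup (M →+ ℝ))

instance : Module ℝ (NR M) := inferInstanceAs (Module ℝ (M →+ ℝ))

instance : FunLike (NR M) M ℝ := inferInstanceAs (FunLike (M →+ ℝ) M ℝ)

instance : AddMonoidHomClass (NR M) M ℝ := inferInstanceAs (AddMonoidHomClass (M →+ ℝ) M ℝ)

/-- The topology of pointwise convergence; for a lattice `M` of finite rank it is the usual
topology of the finite-dimensional vector space `N_ℝ`. -/
instance : TopologicalSpace (NR M) := TopologicalSpace.induced (fun u (m : M) => u m) inferInstance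

/-- The pairing `⟨x, u⟩` between `M_ℝ` and `N_ℝ`; it is determined by `⟨a ⊗ m, u⟩ = a * u m`. -/
def pairing (x : MR M) (u : NR M) : ℝ :=
  LinearMap.liftBaseChange ℝ (AddMonoidHom.toIntLinearMap (show M →+ ℝ from u)) x

/-! ### Convex analysis -/

/-- The support function `Ψ_B(u) = min_{x ∈ B} ⟨x, u⟩` of a nonempty convex body `B` in `M_ℝ`. -/
def supportFunction (B : Set (MR M)) (u : NR M) : ℝ := sInf ((fun x => pairing x u) '' B)

/-- The Legendre-Fenchel dual `g^∨(x) = inf_u (⟨x, u⟩ - g(u)) ∈ ℝ ∪ {-∞}` of a concave function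
`g : N_ℝ → ℝ`. -/
def legendreDual (g : NR M → ℝ) (x : MR M) : EReal := ⨅ u : NR M, ((pairing x u - g u : ℝ) : EReal)

/-- The stability set of `g`: the effective domain of its Legendre-Fenchel dual. -/
def stabilitySet (g : NR M → ℝ) : Set (MR M) := {x | legendreDual g x ≠ ⊥}

/-- `r` is the recession function of the concave function `g : N_ℝ → ℝ`, that is
`r u = lim_{t → ∞} g(v₀ + t u) / t` for every choice of the base point `v₀`. -/
def IsRecessionFunction (g r : NR M → ℝ) : Prop :=
  ∀ v₀ u : NR M, Tendsto (fun t : ℝ => g (v₀ + t • u) / t) atTop (𝓝 (r u))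

end Lattice

/-! ### Analytic torus -/

/-- The Berkovich analytification of the split torus with character lattice `M`: the set of
multiplicative seminorms on the ring `K[M]` of Laurent polynomials which extend the absolute value
of `K`. -/
structure TorusAn (K M : Type*) [NormedField K] [AddCommGroup M] extends
    MulRingSeminorm (AddMonoidAlgebra K M) where
  extends_norm : ∀ k : K, toFun (algebraMap K (AddMonoidAlgebra K M) k) = ‖k‖

variable {K M : Type*} [NormedField K] [AddCommGroup M]

namespace TorusAn

instance : CoeFun (TorusAn K M) fun _ => AddMonoidAlgebra K M → ℝ := ⟨fun x => x.toFun⟩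

/-- The Berkovich topology: the coarsest one for which `x ↦ ‖f‖_x` is continuous for each `f`. -/
instance : TopologicalSpace (TorusAn K M) :=
  TopologicalSpace.induced (fun x (f : AddMonoidAlgebra K M) => x f) inferInstance

instance : MeasurableSpace (TorusAn K M) := borel _

instance : BorelSpace (TorusAn K M) := ⟨rfl⟩

theorem apply_single_mul (x : TorusAn K M) (m m' : M) :
    x (AddMonoidAlgebra.single (m + m') 1)
      = x (AddMonoidAlgebra.single m 1) * x (AddMonoidAlgebra.single m' 1) := by
  rw [← x.map_mul', AddMonoidAlgebra.single_mul_single, one_mul]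

theorem apply_single_ne_zero (x : TorusAn K M) (m : M) :
    x (AddMonoidAlgebra.single m 1) ≠ 0 := by
  intro h
  have h1 := x.apply_single_mul m (-m)
  rw [h, zero_mul, add_neg_cancel] at h1
  exact one_ne_zero (x.map_one'.symm.trans h1)

end TorusAn

/-- The tropicalization map `trop(x)(m) = -log ‖χ^m‖_x`. -/
def trop (x : TorusAn K M) : NR M :=
  AddMonoidHom.mk' (fun m => -Real.log (x (AddMonoidAlgebra.single m 1))) fun m m' => by
    rw [x.apply_single_mul, Real.log_mul (x.apply_single_ne_zero m) (x.apply_single_ne_zero m'),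
      neg_add]

/-- The analytification of the hypersurface `V(f)`, inside that of the torus: the seminorms which
factor through `K[M] / (f)`. -/
def hypersurfaceAn (f : AddMonoidAlgebra K M) : Set (TorusAn K M) := {x | x f = 0}

/-- The amoeba of `f`. -/
def amoeba (f : AddMonoidAlgebra K M) : Set (NR M) := trop '' hypersurfaceAn f

/-- The Newton polytope of `f`: the convex hull in `M_ℝ` of the exponents of `f`. -/
def newtonPolytope (f : AddMonoidAlgebra K M) : Set (MR M) :=
  convexHull ℝ ((fun m : M => (1 : ℝ) ⊗ₜ[ℤ] m) '' (f.coeff.support : Set M))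

/-! ### Gauss points -/

section Gauss

/-- The Gauss norm `max_m |c_m| e^{-⟨m, u⟩}` of `f = ∑ c_m χ^m`. -/
def gaussNorm (u : NR M) (f : AddMonoidAlgebra K M) : ℝ≥0 :=
  f.coeff.support.sup fun m => ‖f.coeff m‖₊ * Real.toNNReal (Real.exp (-u m))

theorem le_gaussNorm (u : NR M) (f : AddMonoidAlgebra K M) (m : M) :
    ‖f.coeff m‖₊ * Real.toNNReal (Real.exp (-u m)) ≤ gaussNorm u f := by
  by_cases h : m ∈ f.coeff.support
  · exact Finset.le_sup (f := fun m => ‖f.coeff m‖₊ * Real.toNNReal (Real.exp (-u m))) h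
  · simp [Finsupp.notMem_support_iff.1 h]

theorem gaussNorm_le_iff (u : NR M) (f : AddMonoidAlgebra K M) (c : ℝ≥0) :
    gaussNorm u f ≤ c ↔ ∀ m, ‖f.coeff m‖₊ * Real.toNNReal (Real.exp (-u m)) ≤ c :=
  ⟨fun h m => (le_gaussNorm u f m).trans h, fun h => Finset.sup_le fun m _ => h m⟩

theorem gaussNorm_single (u : NR M) (m : M) (c : K) :
    gaussNorm u (AddMonoidAlgebra.single m c) = ‖c‖₊ * Real.toNNReal (Real.exp (-u m)) := by
  refine le_antisymm ((gaussNorm_le_iff _ _ _).2 fun m' => ?_) ?_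
  · by_cases h : m = m'
    · subst h; simp
    · simp [h]
  · simpa using le_gaussNorm u (AddMonoidAlgebra.single m c) m

theorem toNNReal_exp_neg_add (u : NR M) (m m' : M) :
    Real.toNNReal (Real.exp (-u (m + m')))
      = Real.toNNReal (Real.exp (-u m)) * Real.toNNReal (Real.exp (-u m')) := by
  rw [← Real.toNNReal_mul (Real.exp_pos _).le, ← Real.exp_add, map_add, neg_add]

theorem gaussNorm_add_le [IsUltrametricDist K] (u : NR M) (f g : AddMonoidAlgebra K M) :
    gaussNorm u (f + g) ≤ max (gaussNorm u f) (gaussNorm u g) := by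
  refine (gaussNorm_le_iff _ _ _).2 fun m => ?_
  rw [AddMonoidAlgebra.coeff_add, Finsupp.add_apply]
  refine (mul_le_mul_left (IsUltrametricDist.nnnorm_add_le_max _ _) _).trans ?_
  rw [max_mul]
  exact max_le_max (le_gaussNorm u f m) (le_gaussNorm u g m)

theorem gaussNorm_mul [IsUltrametricDist K] [Module.Free ℤ M] (u : NR M)
    (f g : AddMonoidAlgebra K M) : gaussNorm u (f * g) = gaussNorm u f * gaussNorm u g := by
  classical
  have hterm : ∀ m a b, a + b = m →
      ‖f.coeff a * g.coeff b‖₊ * Real.toNNReal (Real.exp (-u m))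
        = (‖f.coeff a‖₊ * Real.toNNReal (Real.exp (-u a)))
          * (‖g.coeff b‖₊ * Real.toNNReal (Real.exp (-u b))) := by
    rintro _ a b rfl
    rw [toNNReal_exp_neg_add, nnnorm_mul]
    ring
  have hcoeff : ∀ m, (f * g).coeff m
      = ∑ p ∈ f.coeff.support ×ˢ g.coeff.support,
          if p.1 + p.2 = m then f.coeff p.1 * g.coeff p.2 else 0 := by
    intro m
    rw [AddMonoidAlgebra.coeff_mul, Finset.sum_product]
    rfl
  have hpos : ∀ m, 0 < Real.toNNReal (Real.exp (-u m)) := fun m =>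
    Real.toNNReal_pos.2 (Real.exp_pos _)
  refine le_antisymm ((gaussNorm_le_iff _ _ _).2 fun m => ?_) ?_
  · rw [hcoeff, ← le_div_iff₀ (hpos m)]
    refine IsUltrametricDist.nnnorm_sum_le_of_forall_le fun p _ => ?_
    rw [le_div_iff₀ (hpos m)]
    split_ifs with hp
    · rw [hterm m _ _ hp]
      exact mul_le_mul' (le_gaussNorm u f _) (le_gaussNorm u g _)
    · simp
  · rcases eq_or_ne f 0 with rfl | hf
    · simp [gaussNorm]
    rcases eq_or_ne g 0 with rfl | hg
    · simp [gaussNorm]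
    have hmax : ∀ f : AddMonoidAlgebra K M, f ≠ 0 →
        0 < gaussNorm u f ∧ (f.coeff.support.filter fun m =>
          ‖f.coeff m‖₊ * Real.toNNReal (Real.exp (-u m)) = gaussNorm u f).Nonempty := by
      intro f hf
      have hs : f.coeff.support.Nonempty := by
        rw [Finsupp.support_nonempty_iff]
        simpa using hf
      obtain ⟨m, hm, hm'⟩ := Finset.exists_mem_eq_sup f.coeff.support hs
        fun m => ‖f.coeff m‖₊ * Real.toNNReal (Real.exp (-u m))
      refine ⟨?_, m, Finset.mem_filter.2 ⟨hm, hm'.symm⟩⟩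
      rw [gaussNorm, hm']
      exact mul_pos (nnnorm_pos.2 (Finsupp.mem_support_iff.1 hm)) (hpos m)
    obtain ⟨hfp, hA⟩ := hmax f hf
    obtain ⟨hgp, hB⟩ := hmax g hg
    have : UniqueSums M :=
      UniqueSums.of_injective_addHom (Module.Free.chooseBasis ℤ M).repr.toAddMonoidHom.toAddHom
        (Module.Free.chooseBasis ℤ M).repr.injective inferInstance
    obtain ⟨a, ha, b, hb, hab⟩ := UniqueSums.uniqueAdd_of_nonempty hA hB
    rw [Finset.mem_filter] at ha hb
    have hsplit := hcoeff (a + b)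
    rw [← Finset.add_sum_erase _ _ (Finset.mem_product.2 ⟨ha.1, hb.1⟩ :
      (a, b) ∈ f.coeff.support ×ˢ g.coeff.support)] at hsplit
    rw [if_pos rfl] at hsplit
    by_contra hlt
    push Not at hlt
    have h1 : ‖(f * g).coeff (a + b)‖₊
        < gaussNorm u f * gaussNorm u g / Real.toNNReal (Real.exp (-u (a + b))) := by
      rw [lt_div_iff₀ (hpos _)]
      exact (le_gaussNorm u (f * g) _).trans_lt hlt
    have h2 : ‖∑ p ∈ (f.coeff.support ×ˢ g.coeff.support).erase (a, b),
        if p.1 + p.2 = a + b then f.coeff p.1 * g.coeff p.2 else 0‖₊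
        < gaussNorm u f * gaussNorm u g / Real.toNNReal (Real.exp (-u (a + b))) := by
      refine (IsUltrametricDist.nnnorm_sum_le_of_forall_le
        (fun p hp => Finset.le_sup (f := fun p : M × M =>
          ‖if p.1 + p.2 = a + b then f.coeff p.1 * g.coeff p.2 else 0‖₊) hp)).trans_lt
        ((Finset.sup_lt_iff ?_).2 ?_)
      · exact div_pos (mul_pos hfp hgp) (hpos _)
      intro p hp
      rw [lt_div_iff₀ (hpos _)]
      split_ifs with hpab
      · rw [hterm _ _ _ hpab]
        refine lt_of_le_of_ne (mul_le_mul' (le_gaussNorm u f _) (le_gaussNorm u g _)) fun heq => ?_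
        obtain ⟨hne, hp'⟩ := Finset.mem_erase.1 hp
        have hp'' := Finset.mem_product.1 hp'
        have e1 : ‖f.coeff p.1‖₊ * Real.toNNReal (Real.exp (-u p.1)) = gaussNorm u f := by
          refine le_antisymm (le_gaussNorm u f _) (le_of_not_gt fun hl => ?_)
          exact (mul_lt_mul_of_lt_of_le_of_nonneg_of_pos hl (le_gaussNorm u g p.2)
            zero_le hgp).ne heq
        have e2 : ‖g.coeff p.2‖₊ * Real.toNNReal (Real.exp (-u p.2)) = gaussNorm u g := by
          rw [e1] at heq
          exact mul_left_cancel₀ hfp.ne' heq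
        obtain ⟨q1, q2⟩ := hab (Finset.mem_filter.2 ⟨hp''.1, e1⟩)
          (Finset.mem_filter.2 ⟨hp''.2, e2⟩) hpab
        exact hne (Prod.ext q1 q2)
      · simpa using mul_pos hfp hgp
    have h3 : ‖f.coeff a * g.coeff b‖₊
        < gaussNorm u f * gaussNorm u g / Real.toNNReal (Real.exp (-u (a + b))) := by
      rw [eq_sub_of_add_eq hsplit.symm, sub_eq_add_neg]
      refine (IsUltrametricDist.nnnorm_add_le_max _ _).trans_lt (max_lt h1 ?_)
      rwa [nnnorm_neg]
    rw [lt_div_iff₀ (hpos _), hterm _ a b rfl, ha.2, hb.2] at h3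
    exact lt_irrefl _ h3

/-- The Gauss point `κ(u)` of the analytic torus over a non-archimedean field. -/
def gaussPoint [IsUltrametricDist K] [Module.Free ℤ M] (u : NR M) : TorusAn K M where
  toFun f := gaussNorm u f
  map_zero' := by simp [gaussNorm]
  add_le' f g := by
    have := (gaussNorm_add_le u f g).trans (max_le_add_of_nonneg zero_le zero_le)
    exact_mod_cast this
  neg' f := by simp [gaussNorm]
  map_one' := by
    rw [AddMonoidAlgebra.one_def, gaussNorm_single]
    simp
  map_mul' f g := by rw [gaussNorm_mul, NNReal.coe_mul]
  extends_norm k := by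
    rw [AddMonoidAlgebra.coe_algebraMap, Function.comp_apply, gaussNorm_single]
    simp

end Gauss

/-! ### Rational points -/

/-- The `K`-rational point of the torus given by a character `z : M → K^*`, as the seminorm
`f ↦ |f(z)|`. -/
def evalPoint (z : Multiplicative M →* K) : TorusAn K M where
  toFun f := ‖AddMonoidAlgebra.lift K K M z f‖
  map_zero' := by simp
  add_le' f g := by rw [map_add]; exact norm_add_le _ _
  neg' f := by rw [map_neg, norm_neg]
  map_one' := by simp
  map_mul' f g := by rw [map_mul, norm_mul]
  extends_norm k := by simp

section Arch

variable [CompleteSpace K] [IsAlgClosed K] [Module.Free ℤ M] [Module.Finite ℤ M]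

/-- An archimedean algebraically closed complete field is `ℂ` with a power of the usual absolute
value; the exponent. -/
def archExponent (h : ¬ IsUltrametricDist K) : ℝ := (exists_complex_ringEquiv h).choose

/-- An archimedean algebraically closed complete field is `ℂ` with a power of the usual absolute
value; the identification. -/
def archEquiv (h : ¬ IsUltrametricDist K) : ℂ ≃+* K := (exists_complex_ringEquiv h).choose_spec.choose

theorem archExponent_pos (h : ¬ IsUltrametricDist K) : 0 < archExponent h :=
  (exists_complex_ringEquiv h).choose_spec.choose_spec.1

theorem norm_archEquiv (h : ¬ IsUltrametricDist K) (z : ℂ) :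
    ‖archEquiv h z‖ = ‖z‖ ^ archExponent h :=
  (exists_complex_ringEquiv h).choose_spec.choose_spec.2 z

/-- The index set of a basis of the lattice `M`. -/
abbrev BasisIndex (M : Type*) [AddCommGroup M] [Module.Free ℤ M] : Type _ :=
  Module.Free.ChooseBasisIndex ℤ M

/-- In the coordinates given by a basis of `M`, the point
`(e^{-u_1 + i θ_1}, …, e^{-u_n + i θ_n})` of the archimedean torus, with `θ_j = 2 π t_j`.
If the absolute value of `K = ℂ` is the `s`-th power of the usual one, then `u_j` has to be replaced
by `u_j / s`, so that the point still tropicalizes to `u`. -/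
def archPoint (h : ¬ IsUltrametricDist K) (u : NR M) (t : UnitAddTorus (BasisIndex M)) :
    TorusAn K M :=
  evalPoint
    { toFun := fun m => archEquiv h
        (Complex.exp ((-u m.toAdd / archExponent h : ℝ) : ℂ) *
          UnitAddTorus.mFourier ((Module.Free.chooseBasis ℤ M).repr m.toAdd) t)
      map_one' := by
        have h0 : u 0 = 0 := map_zero u
        rw [toAdd_one, h0, map_zero, Finsupp.coe_zero, UnitAddTorus.mFourier_zero]
        simp
      map_mul' := fun m m' => by
        have h0 : u (m.toAdd + m'.toAdd) = u m.toAdd + u m'.toAdd := map_add u _ _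
        rw [← map_mul, toAdd_mul, h0, map_add, Finsupp.coe_add, UnitAddTorus.mFourier_add, neg_add,
          add_div, Complex.ofReal_add, Complex.exp_add]
        congr 1
        ring }

open Classical in
/-- The measure `σ_u` on the fibre `trop⁻¹(u)`. Over an archimedean field it is the normalized Haar
measure of the whole fibre, which is a torsor under the compact torus `(S¹)ⁿ`; over a
non-archimedean field it is the Dirac measure at the Gauss point over `u`. -/
def fibreMeasure (u : NR M) : Measure (TorusAn K M) :=
  if h : IsUltrametricDist K then Measure.dirac (gaussPoint u)
  else (volume : Measure (UnitAddTorus (BasisIndex M))).map (archPoint h u)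

/-- The Ronkin function `ρ_f(u) = ∫_{trop⁻¹(u)} -log ‖f‖_x dσ_u(x)`. -/
def ronkin (f : AddMonoidAlgebra K M) (u : NR M) : ℝ :=
  ∫ x in trop ⁻¹' {u}, -Real.log (x f) ∂(fibreMeasure u)

end Arch

end

end Ronkin

/-! Over a non-archimedean field the Ronkin function is minus the logarithm of a Gauss norm
(`ronkin_of_nonarch`), hence the minimum of the finitely many affine functions `monomialOrder f m`.
Concavity, continuity and bounded distance to the support function are then immediate. Where two
exponents attain the minimum, `u` lies in the amoeba (`mem_amoeba_of_two_maxima`). The loci where a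
given exponent is the only minimizer are open and disjoint, so a connected set off the amoeba stays
in one of them.

Over an archimedean field, `K` is `ℂ` with the `s`-th power of the usual absolute value, and the
Ronkin function is `-s` times the mean of `log |f|` over a compact torus, in coordinates divided by
`s` (`ronkin_of_arch`). This mean is computed by averaging over the orbits of a one-parameter
subgroup of integral direction `v` (`torusMean_shift`), on which `f` becomes a Laurent polynomial in
one variable. Jensen's formula (`laurentMean_eq`) makes each inner mean an explicit piecewise affine
function of the displacement `τ` along `v`: convex, Lipschitz with a constant independent of the
orbit, and affine as long as no zero is met. Integration preserves all three properties. Lipschitz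
bounds along the axes give continuity, and density of rational directions gives convexity
everywhere. Over the complement of the amoeba the mean is also locally concave, hence locally
affine, and the identity theorem spreads one affine map over a connected set.

Comparison with the support function uses the triangle inequality on one side and, on the other,
Mahler's bound of a coefficient by the Mahler measure, along a direction `v` that separates the
exponents (`le_torusMean_add`). The same bound gives absolute convergence of the integral.

In both cases the stability set and the recession function follow from the bounded distance alone
(`stabilitySet_of_bounded`, `isRecessionFunction_of_bounded`). -/

namespace Ronkin

/-! ### Mean values of one-variable polynomials -/

section OneVariable

open Polynomial

instance isProbabilityMeasure_unitAddCircle :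
    IsProbabilityMeasure (volume : Measure UnitAddCircle) :=
  ⟨UnitAddCircle.measure_univ⟩

/-- The point of modulus `r` and argument `2 π s`. -/
noncomputable def polar (r : ℝ) (s : UnitAddCircle) : ℂ := (r : ℂ) * fourier 1 s

theorem polar_injective {r : ℝ} (hr : 0 < r) : Function.Injective (polar r) := by
  intro s s' h
  have h1 : (fourier 1 s : ℂ) = fourier 1 s' :=
    mul_left_cancel₀ (by exact_mod_cast hr.ne') h
  rw [fourier_one, fourier_one] at h1
  exact AddCircle.injective_toCircle one_ne_zero (Subtype.ext h1)

theorem norm_polar {r : ℝ} (hr : 0 < r) (s : UnitAddCircle) : ‖polar r s‖ = r := by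
  rw [polar, fourier_one, norm_mul, Circle.norm_coe, mul_one, Complex.norm_real,
    Real.norm_of_nonneg hr.le]

theorem polar_ne_zero {r : ℝ} (hr : 0 < r) (s : UnitAddCircle) : polar r s ≠ 0 := by
  rw [← norm_pos_iff, norm_polar hr]
  exact hr

theorem polar_coe (r x : ℝ) : polar r (x : UnitAddCircle) = circleMap 0 r (2 * Real.pi * x) := by
  rw [polar, fourier_coe_apply, circleMap]
  push_cast
  rw [zero_add]
  congr 2
  ring

theorem exists_polar_eq (z : ℂ) : ∃ s, polar ‖z‖ s = z := by
  refine ⟨((Complex.arg z / (2 * Real.pi) : ℝ) : UnitAddCircle), ?_⟩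
  rw [polar_coe, circleMap, mul_div_cancel₀ _ (by positivity), zero_add,
    Complex.norm_mul_exp_arg_mul_I]

theorem measure_finite_unitAddCircle {S : Set UnitAddCircle} (hS : S.Finite) :
    (volume : Measure UnitAddCircle) S = 0 := by
  have h1 : ∀ x : UnitAddCircle, (volume : Measure UnitAddCircle) {x} = 0 := by
    intro x
    have := AddCircle.volume_closedBall (T := (1 : ℝ)) (x := x) 0
    simpa using this
  rw [← Set.biUnion_of_singleton S]
  exact (measure_biUnion_null_iff hS.countable).2 fun x _ => h1 x

theorem integral_polar (g : ℂ → ℝ) (r : ℝ) :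
    ∫ s : UnitAddCircle, g (polar r s) = Real.circleAverage g 0 r := by
  rw [← UnitAddCircle.intervalIntegral_preimage 0, Real.circleAverage_def]
  simp_rw [polar_coe]
  rw [intervalIntegral.integral_comp_mul_left (fun x => g (circleMap 0 r x))
    (by positivity : 2 * Real.pi ≠ 0)]
  simp

theorem integrable_polar {g : ℂ → ℝ} {r : ℝ} (hg : CircleIntegrable g 0 r)
    (hm : Measurable g) : Integrable fun s : UnitAddCircle => g (polar r s) := by
  have hc : Continuous fun s : UnitAddCircle => polar r s := by unfold polar; fun_prop
  have hme : AEStronglyMeasurable (fun s : UnitAddCircle => g (polar r s)) volume :=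
    (hm.comp hc.measurable).aestronglyMeasurable
  rw [← (UnitAddCircle.measurePreserving_mk 0).integrable_comp hme]
  have h1 : IntervalIntegrable (fun x => g (circleMap 0 r (2 * Real.pi * x))) volume 0 1 := by
    have := (hg : IntervalIntegrable (fun x => g (circleMap 0 r x)) volume 0
      (2 * Real.pi)).comp_mul_left (c := 2 * Real.pi)
    simpa [Real.pi_ne_zero] using this
  rw [intervalIntegrable_iff_integrableOn_Ioc_of_le zero_le_one] at h1
  rw [zero_add]
  refine h1.congr (ae_of_all _ fun x => ?_)
  exact congrArg g (polar_coe r x).symm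

theorem integrable_log_norm_eval_polar (p : ℂ[X]) {r : ℝ} :
    Integrable fun s : UnitAddCircle => Real.log ‖p.eval (polar r s)‖ := by
  refine integrable_polar (g := fun z => Real.log ‖p.eval z‖)
    (MeromorphicOn.circleIntegrable_log_norm ?_) ?_
  · exact fun z _ => (AnalyticAt.aeval_polynomial analyticAt_id p).meromorphicAt
  · exact Real.measurable_log.comp p.continuous.norm.measurable

theorem ae_eval_polar_ne_zero {p : ℂ[X]} (hp : p ≠ 0) {r : ℝ} (hr : 0 < r) :
    ∀ᵐ s : UnitAddCircle, p.eval (polar r s) ≠ 0 := by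
  rw [ae_iff]
  simp only [not_not]
  refine measure_finite_unitAddCircle (Set.Finite.preimage (f := polar r)
    ((polar_injective hr).injOn) (s := {z | p.eval z = 0}) ?_)
  exact (p.roots.toFinset.finite_toSet).subset fun z hz => by
    simpa [hp] using hz

theorem integral_log_norm_eval_polar (p : ℂ[X]) (r : ℝ) :
    ∫ s : UnitAddCircle, Real.log ‖p.eval (polar r s)‖
      = (p.comp (C (r : ℂ) * X)).logMahlerMeasure := by
  rw [integral_polar (fun z => Real.log ‖p.eval z‖), logMahlerMeasure_def,
    Real.circleAverage_def, Real.circleAverage_def]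
  congr 1
  refine intervalIntegral.integral_congr fun x _ => ?_
  simp [circleMap]

/-- Mahler's inequality in logarithmic form: the source of every lower bound on the means, and hence
of integrability. -/
theorem log_norm_coeff_le_integral (p : ℂ[X]) {k : ℕ} (hk : p.coeff k ≠ 0) :
    Real.log ‖p.coeff k‖ ≤ Real.log (p.natDegree.choose k)
      + ∫ s : UnitAddCircle, Real.log ‖p.eval (polar 1 s)‖ := by
  have hp : p ≠ 0 := by rintro rfl; simp at hk
  have h1 := p.norm_coeff_le_choose_mul_mahlerMeasure k
  have h2 : (0 : ℝ) < p.natDegree.choose k := by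
    exact_mod_cast Nat.choose_pos (le_natDegree_of_ne_zero hk)
  rw [integral_log_norm_eval_polar, Complex.ofReal_one, C_1, one_mul, comp_X,
    logMahlerMeasure_eq_log_MahlerMeasure,
    ← Real.log_mul h2.ne' (mahlerMeasure_pos_of_ne_zero hp).ne']
  exact Real.log_le_log (norm_pos_iff.2 hk) h1

/-- The mean value of `log ‖z - α‖` on the circle of radius `e^{-τ}`. -/
noncomputable def rootTerm (α : ℂ) (τ : ℝ) : ℝ := -τ + Real.posLog (Real.exp τ * ‖α‖)

/-- Jensen's formula: the logarithmic Mahler measure is additive on the factorization into linear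
terms, and each root contributes its `rootTerm`. -/
theorem logMahlerMeasure_comp_exp {p : ℂ[X]} (hp : p ≠ 0) (τ : ℝ) :
    (p.comp (C ((Real.exp (-τ) : ℝ) : ℂ) * X)).logMahlerMeasure
      = Real.log ‖p.leadingCoeff‖ + (p.roots.map fun α => rootTerm α τ).sum := by
  have hr : ((Real.exp (-τ) : ℝ) : ℂ) ≠ 0 := by exact_mod_cast (Real.exp_pos _).ne'
  have hlin : ∀ α : ℂ, C ((Real.exp (-τ) : ℝ) : ℂ) * X - C α ≠ 0 := by
    intro α h
    have := congrArg (fun q : ℂ[X] => q.coeff 1) h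
    simp [coeff_C] at this
  have hterm : ∀ α : ℂ, (C ((Real.exp (-τ) : ℝ) : ℂ) * X - C α).logMahlerMeasure
      = rootTerm α τ := by
    intro α
    rw [sub_eq_add_neg, ← C_neg, logMahlerMeasure_C_mul_X_add_C hr, rootTerm]
    rw [norm_mul, norm_neg, norm_inv, Complex.norm_real, Real.norm_of_nonneg (Real.exp_pos _).le,
      Real.log_exp, ← Real.exp_neg, neg_neg]
  have hprod : ∀ s : Multiset ℂ,
      (s.map fun α => C ((Real.exp (-τ) : ℝ) : ℂ) * X - C α).prod ≠ 0 ∧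
      (s.map fun α => C ((Real.exp (-τ) : ℝ) : ℂ) * X - C α).prod.logMahlerMeasure
        = (s.map fun α => rootTerm α τ).sum := by
    intro s
    induction s using Multiset.induction_on with
    | empty => simp
    | cons a s ih =>
      simp only [Multiset.map_cons, Multiset.prod_cons, Multiset.sum_cons]
      have h0 := mul_ne_zero (hlin a) ih.1
      exact ⟨h0, by rw [logMahlerMeasure_mul_eq_add_logMahlerMeasure h0, ih.2, hterm]⟩
  conv_lhs => rw [(IsAlgClosed.splits p).eq_prod_roots]
  rw [mul_comp, C_comp, multiset_prod_comp, Multiset.map_map]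
  have : (fun q : ℂ[X] => q.comp (C ((Real.exp (-τ) : ℝ) : ℂ) * X)) ∘ (fun x => X - C x)
      = fun α => C ((Real.exp (-τ) : ℝ) : ℂ) * X - C α := by
    funext α; simp
  rw [this, logMahlerMeasure_C_mul (leadingCoeff_ne_zero.2 hp) (hprod _).1, (hprod _).2]

theorem rootTerm_zero : rootTerm 0 = fun τ => -τ := by
  funext τ; simp [rootTerm]

/-- The root `0` is treated apart because `Real.log 0 = 0` would falsify the formula. -/
theorem rootTerm_of_ne_zero {α : ℂ} (hα : α ≠ 0) (τ : ℝ) :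
    rootTerm α τ = max (-τ) (Real.log ‖α‖) := by
  rw [rootTerm, Real.posLog_def]
  simp only [Pi.sup_apply, Pi.zero_apply]
  rw [Real.log_mul (Real.exp_pos _).ne' (norm_ne_zero_iff.2 hα), Real.log_exp, ← max_add_add_left]
  simp

theorem rootTerm_convex (α : ℂ) (τ τ' : ℝ) {a b : ℝ} (ha : 0 ≤ a) (hb : 0 ≤ b) (hab : a + b = 1) :
    rootTerm α (a * τ + b * τ') ≤ a * rootTerm α τ + b * rootTerm α τ' := by
  rcases eq_or_ne α 0 with rfl | hα
  · simp only [rootTerm_zero]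
    linarith
  · simp only [rootTerm_of_ne_zero hα]
    have hl : Real.log ‖α‖ = a * Real.log ‖α‖ + b * Real.log ‖α‖ := by
      rw [← add_mul, hab, one_mul]
    refine max_le ?_ (hl.trans_le ?_)
    · have := mul_le_mul_of_nonneg_left (le_max_left (-τ) (Real.log ‖α‖)) ha
      have := mul_le_mul_of_nonneg_left (le_max_left (-τ') (Real.log ‖α‖)) hb
      linarith
    · exact add_le_add (mul_le_mul_of_nonneg_left (le_max_right _ _) ha)
        (mul_le_mul_of_nonneg_left (le_max_right _ _) hb)

theorem rootTerm_lipschitz (α : ℂ) (τ τ' : ℝ) : |rootTerm α τ - rootTerm α τ'| ≤ |τ - τ'| := by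
  rcases eq_or_ne α 0 with rfl | hα
  · simp only [rootTerm_zero]
    rw [neg_sub_neg, abs_sub_comm]
  · simp only [rootTerm_of_ne_zero hα]
    refine (abs_max_sub_max_le_abs _ _ _).trans ?_
    rw [neg_sub_neg, abs_sub_comm]

/-- The only kink is at `τ = -log ‖α‖`, and the hypothesis keeps it off the segment, so both end
points lie on the same side of it. -/
theorem rootTerm_affine {α : ℂ} {τ τ' : ℝ} {a b : ℝ} (ha : 0 ≤ a) (hb : 0 ≤ b) (hab : a + b = 1)
    (h : ∀ x ∈ segment ℝ τ τ', ‖α‖ ≠ Real.exp (-x)) :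
    rootTerm α (a * τ + b * τ') = a * rootTerm α τ + b * rootTerm α τ' := by
  rcases eq_or_ne α 0 with rfl | hα
  · simp only [rootTerm_zero]
    ring
  · simp only [rootTerm_of_ne_zero hα]
    set l := Real.log ‖α‖ with hl
    have hl' : ∀ x ∈ segment ℝ τ τ', l ≠ -x := by
      intro x hx hlx
      refine h x hx ?_
      rw [← hlx, hl, Real.exp_log (norm_pos_iff.2 hα)]
    rcases le_or_gt l (-τ) with h1 | h1 <;> rcases le_or_gt l (-τ') with h2 | h2
    · rw [max_eq_left h1, max_eq_left h2, max_eq_left]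
      · ring
      · have := mul_le_mul_of_nonneg_left h1 ha
        have := mul_le_mul_of_nonneg_left h2 hb
        have : l = a * l + b * l := by rw [← add_mul, hab, one_mul]
        linarith
    · have hs : -l ∈ segment ℝ τ τ' := by
        rw [segment_eq_uIcc]
        exact Set.mem_uIcc.2 (Or.inl ⟨by linarith, by linarith⟩)
      exact (hl' (-l) hs (neg_neg l).symm).elim
    · have hs : -l ∈ segment ℝ τ τ' := by
        rw [segment_eq_uIcc]
        exact Set.mem_uIcc.2 (Or.inr ⟨by linarith, by linarith⟩)
      exact (hl' (-l) hs (neg_neg l).symm).elim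
    · rw [max_eq_right h1.le, max_eq_right h2.le, max_eq_right]
      · rw [← add_mul, hab, one_mul]
      · have := mul_le_mul_of_nonneg_left h1.le ha
        have := mul_le_mul_of_nonneg_left h2.le hb
        have : l = a * l + b * l := by rw [← add_mul, hab, one_mul]
        linarith

/-! ### Mean values of one-variable Laurent polynomials -/

variable {A : Type*} (S : Finset A) (β : A → ℂ) (n : A → ℤ)

/-- The value of a Laurent polynomial in one variable. -/
noncomputable def laurentEval (z : ℂ) : ℂ := ∑ a ∈ S, β a * z ^ n a

/-- The polynomial `z ^ N * ∑ β_a z^{n_a}`. -/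
noncomputable def shiftedPoly (N : ℕ) : ℂ[X] := ∑ a ∈ S, C (β a) * X ^ (n a + N).toNat

/-- The mean value of the logarithm of a Laurent polynomial on the circle of radius `e^{-τ}`. -/
noncomputable def laurentMean (τ : ℝ) : ℝ :=
  ∫ s : UnitAddCircle, Real.log ‖laurentEval S β n (polar (Real.exp (-τ)) s)‖

variable {S β n} {N : ℕ}

theorem shiftedPoly_eval (hN : ∀ a ∈ S, |n a| ≤ N) {z : ℂ} (hz : z ≠ 0) :
    (shiftedPoly S β n N).eval z = z ^ N * laurentEval S β n z := by
  rw [shiftedPoly, eval_finsetSum, laurentEval, Finset.mul_sum]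
  refine Finset.sum_congr rfl fun a ha => ?_
  have h0 : 0 ≤ n a + N := by linarith [neg_le_of_abs_le (hN a ha)]
  have h1 : z ^ (n a + N).toNat = z ^ N * z ^ n a := by
    rw [← zpow_natCast, Int.toNat_of_nonneg h0, zpow_add₀ hz, mul_comm, zpow_natCast]
  simp only [eval_mul, eval_C, eval_pow, eval_X]
  rw [h1]
  ring

theorem natDegree_shiftedPoly_le (hN : ∀ a ∈ S, |n a| ≤ N) :
    (shiftedPoly S β n N).natDegree ≤ 2 * N := by
  refine natDegree_sum_le_of_forall_le _ _ fun a ha => ?_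
  refine (natDegree_C_mul_X_pow_le _ _).trans ?_
  have := le_of_abs_le (hN a ha)
  omega

theorem shiftedPoly_coeff (hN : ∀ a ∈ S, |n a| ≤ N) (hn : Set.InjOn n S) {a : A} (ha : a ∈ S) :
    (shiftedPoly S β n N).coeff (n a + N).toNat = β a := by
  rw [shiftedPoly, finsetSum_coeff, Finset.sum_eq_single_of_mem a ha]
  · simp
  · intro a' ha' hne
    rw [coeff_C_mul, coeff_X_pow, if_neg, mul_zero]
    intro h
    apply hne
    refine hn ha' ha ?_
    have h1 := neg_le_of_abs_le (hN a ha)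
    have h2 := neg_le_of_abs_le (hN a' ha')
    omega

/-- Zeros must be excluded: there both logarithms take the default value `0` and the shift `N * τ`
would be wrong. -/
theorem log_norm_laurentEval (hN : ∀ a ∈ S, |n a| ≤ N) (τ : ℝ) (s : UnitAddCircle)
    (h : (shiftedPoly S β n N).eval (polar (Real.exp (-τ)) s) ≠ 0) :
    Real.log ‖laurentEval S β n (polar (Real.exp (-τ)) s)‖
      = N * τ + Real.log ‖(shiftedPoly S β n N).eval (polar (Real.exp (-τ)) s)‖ := by
  have hz := polar_ne_zero (Real.exp_pos (-τ)) s
  rw [shiftedPoly_eval hN hz] at h ⊢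
  rw [norm_mul, norm_pow, norm_polar (Real.exp_pos _), Real.log_mul (by positivity)
    (norm_ne_zero_iff.2 (right_ne_zero_of_mul h)), Real.log_pow, Real.log_exp]
  ring

theorem laurentEval_eq_zero (hN : ∀ a ∈ S, |n a| ≤ N) (h : shiftedPoly S β n N = 0) {z : ℂ}
    (hz : z ≠ 0) : laurentEval S β n z = 0 := by
  have := shiftedPoly_eval (β := β) hN hz
  rw [h, eval_zero] at this
  exact (mul_eq_zero.1 this.symm).resolve_left (pow_ne_zero _ hz)

/-- When `n` is not injective on `S`, terms may cancel and the restriction may vanish identically.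
The convention `log 0 = 0` then makes the mean zero, and the properties below hold trivially. -/
theorem laurentMean_eq_zero (hN : ∀ a ∈ S, |n a| ≤ N) (h : shiftedPoly S β n N = 0) :
    laurentMean S β n = 0 := by
  funext τ
  simp [laurentMean, laurentEval_eq_zero hN h (polar_ne_zero (Real.exp_pos _) _)]

/-- Jensen's formula turns the mean into an affine function of `τ` plus a finite sum of `rootTerm`s,
from which convexity, affinity and the Lipschitz bound are read off. -/
theorem laurentMean_eq (hN : ∀ a ∈ S, |n a| ≤ N) (h : shiftedPoly S β n N ≠ 0) (τ : ℝ) :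
    laurentMean S β n τ = N * τ + (Real.log ‖(shiftedPoly S β n N).leadingCoeff‖
      + ((shiftedPoly S β n N).roots.map fun α => rootTerm α τ).sum) := by
  rw [← logMahlerMeasure_comp_exp h, ← integral_log_norm_eval_polar, laurentMean]
  rw [integral_congr_ae ((ae_eval_polar_ne_zero h (Real.exp_pos (-τ))).mono fun s hs =>
    log_norm_laurentEval hN τ s hs),
    integral_add (integrable_const _) (integrable_log_norm_eval_polar _)]
  simp

theorem integrable_log_norm_laurentEval (hN : ∀ a ∈ S, |n a| ≤ N) (τ : ℝ) :
    Integrable fun s : UnitAddCircle =>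
      Real.log ‖laurentEval S β n (polar (Real.exp (-τ)) s)‖ := by
  by_cases h : shiftedPoly S β n N = 0
  · simp [laurentEval_eq_zero hN h (polar_ne_zero (Real.exp_pos _) _)]
  · refine Integrable.congr ((integrable_const (N * τ)).add
      (integrable_log_norm_eval_polar (shiftedPoly S β n N) (r := Real.exp (-τ)))) ?_
    exact (ae_eval_polar_ne_zero h (Real.exp_pos (-τ))).mono fun s hs =>
      (log_norm_laurentEval hN τ s hs).symm

theorem laurentMean_convex (hN : ∀ a ∈ S, |n a| ≤ N) (τ τ' : ℝ) {a b : ℝ} (ha : 0 ≤ a)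
    (hb : 0 ≤ b) (hab : a + b = 1) : laurentMean S β n (a * τ + b * τ')
      ≤ a * laurentMean S β n τ + b * laurentMean S β n τ' := by
  by_cases h : shiftedPoly S β n N = 0
  · simp [laurentMean_eq_zero hN h]
  · simp only [laurentMean_eq hN h]
    have := Multiset.sum_map_le_sum_map (s := (shiftedPoly S β n N).roots)
      (fun α => rootTerm α (a * τ + b * τ')) (fun α => a * rootTerm α τ + b * rootTerm α τ')
      fun α _ => rootTerm_convex α τ τ' ha hb hab
    rw [Multiset.sum_map_add, Multiset.sum_map_mul_left, Multiset.sum_map_mul_left] at this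
    have hl : Real.log ‖(shiftedPoly S β n N).leadingCoeff‖
        = a * Real.log ‖(shiftedPoly S β n N).leadingCoeff‖
          + b * Real.log ‖(shiftedPoly S β n N).leadingCoeff‖ := by rw [← add_mul, hab, one_mul]
    linarith

theorem laurentMean_affine (hN : ∀ a ∈ S, |n a| ≤ N) {τ τ' : ℝ} {a b : ℝ} (ha : 0 ≤ a)
    (hb : 0 ≤ b) (hab : a + b = 1)
    (h0 : ∀ x ∈ segment ℝ τ τ', ∀ s, laurentEval S β n (polar (Real.exp (-x)) s) ≠ 0) :
    laurentMean S β n (a * τ + b * τ')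
      = a * laurentMean S β n τ + b * laurentMean S β n τ' := by
  by_cases h : shiftedPoly S β n N = 0
  · simp [laurentMean_eq_zero hN h]
  · simp only [laurentMean_eq hN h]
    have : (shiftedPoly S β n N).roots.map (fun α => rootTerm α (a * τ + b * τ'))
        = (shiftedPoly S β n N).roots.map (fun α => a * rootTerm α τ + b * rootTerm α τ') := by
      refine Multiset.map_congr rfl fun α hα => rootTerm_affine ha hb hab fun x hx hαx => ?_
      have hα0 : α ≠ 0 := by
        rw [← norm_pos_iff, hαx]; exact Real.exp_pos _
      obtain ⟨s, hs⟩ := exists_polar_eq α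
      rw [hαx] at hs
      have hev := shiftedPoly_eval (β := β) hN hα0
      rw [(isRoot_of_mem_roots hα).eq_zero] at hev
      refine h0 x hx s ?_
      rw [hs]
      exact (mul_eq_zero.1 hev.symm).resolve_left (pow_ne_zero _ hα0)
    rw [this, Multiset.sum_map_add, Multiset.sum_map_mul_left, Multiset.sum_map_mul_left]
    have hl : Real.log ‖(shiftedPoly S β n N).leadingCoeff‖
        = a * Real.log ‖(shiftedPoly S β n N).leadingCoeff‖
          + b * Real.log ‖(shiftedPoly S β n N).leadingCoeff‖ := by rw [← add_mul, hab, one_mul]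
    linarith

/-- The slope `N` comes from the shift, and there are at most `2 * N` roots, each with a 1-Lipschitz
term. The constant does not involve the coefficients, so it survives averaging over slices. -/
theorem laurentMean_lipschitz (hN : ∀ a ∈ S, |n a| ≤ N) (τ τ' : ℝ) :
    |laurentMean S β n τ - laurentMean S β n τ'| ≤ 3 * N * |τ - τ'| := by
  by_cases h : shiftedPoly S β n N = 0
  · simp only [laurentMean_eq_zero hN h, Pi.zero_apply, sub_zero, abs_zero]
    positivity
  · simp only [laurentMean_eq hN h]
    have key : ∀ R : Multiset ℂ, |(R.map fun α => rootTerm α τ).sum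
        - (R.map fun α => rootTerm α τ').sum| ≤ R.card * |τ - τ'| := by
      intro R
      induction R using Multiset.induction_on with
      | empty => simp
      | cons α R ih =>
        simp only [Multiset.map_cons, Multiset.sum_cons, Multiset.card_cons]
        have := rootTerm_lipschitz α τ τ'
        rw [add_sub_add_comm]
        refine (abs_add_le _ _).trans ?_
        push_cast
        linarith
    have hc : ((shiftedPoly S β n N).roots.card : ℝ) ≤ 2 * N := by
      exact_mod_cast (card_roots' _).trans (natDegree_shiftedPoly_le hN)
    have h1 := (key (shiftedPoly S β n N).roots).trans
      (mul_le_mul_of_nonneg_right hc (abs_nonneg (τ - τ')))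
    rw [show ∀ x y z w c : ℝ, x + (c + y) - (z + (c + w)) = (x - z) + (y - w) by intros; ring,
      ← mul_sub]
    refine (abs_add_le _ _).trans ?_
    rw [abs_mul, Nat.abs_cast]
    linarith

/-- Injectivity of `n` makes `β a` itself a coefficient of the shifted polynomial. The binomial
coefficient in Mahler's inequality is at most `2 ^ (2 * N)`. -/
theorem log_norm_le_laurentMean (hN : ∀ a ∈ S, |n a| ≤ N) (hn : Set.InjOn n S) {a : A}
    (ha : a ∈ S) (hβ : β a ≠ 0) :
    Real.log ‖β a‖ ≤ 2 * N * Real.log 2 + laurentMean S β n 0 := by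
  set p := shiftedPoly S β n N with hp
  have hc : p.coeff (n a + N).toNat = β a := shiftedPoly_coeff hN hn ha
  have hp0 : p ≠ 0 := by
    intro h
    rw [h, coeff_zero] at hc
    exact hβ hc.symm
  have h1 := log_norm_coeff_le_integral p (hc ▸ hβ)
  rw [hc] at h1
  have h2 : laurentMean S β n 0 = ∫ s : UnitAddCircle, Real.log ‖p.eval (polar 1 s)‖ := by
    rw [laurentMean]
    refine integral_congr_ae ?_
    filter_upwards [ae_eval_polar_ne_zero hp0 (Real.exp_pos (-0))] with s hs
    rw [log_norm_laurentEval hN 0 s hs]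
    simp [hp]
  rw [← h2] at h1
  refine h1.trans (add_le_add_left ?_ _)
  have h3 : (p.natDegree.choose (n a + N).toNat : ℝ) ≤ 2 ^ (2 * N) := by
    exact_mod_cast (Nat.choose_le_two_pow _ _).trans
      (Nat.pow_le_pow_right (by norm_num) (natDegree_shiftedPoly_le hN))
  have h4 : (0 : ℝ) < p.natDegree.choose (n a + N).toNat := by
    exact_mod_cast Nat.choose_pos (le_natDegree_of_ne_zero (hc ▸ hβ))
  refine (Real.log_le_log h4 h3).trans (le_of_eq ?_)
  rw [Real.log_pow]
  push_cast
  ring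

theorem ae_laurentEval_ne_zero (hN : ∀ a ∈ S, |n a| ≤ N) (hn : Set.InjOn n S) {a : A}
    (ha : a ∈ S) (hβ : β a ≠ 0) (τ : ℝ) :
    ∀ᵐ s : UnitAddCircle, laurentEval S β n (polar (Real.exp (-τ)) s) ≠ 0 := by
  have hp0 : shiftedPoly S β n N ≠ 0 := by
    intro h
    have hc := shiftedPoly_coeff (β := β) hN hn ha
    rw [h, coeff_zero] at hc
    exact hβ hc.symm
  filter_upwards [ae_eval_polar_ne_zero hp0 (Real.exp_pos (-τ))] with s hs
  rw [shiftedPoly_eval hN (polar_ne_zero (Real.exp_pos (-τ)) s)] at hs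
  exact right_ne_zero_of_mul hs

end OneVariable

/-! ### Mean values of Laurent polynomials on compact tori -/

section Torus

/-- Take `v = (1, x, x², …)`. Two distinct exponents have equal products with `v` only if `x` is a
root of a nonzero polynomial, so all but finitely many integers `x` work. -/
theorem exists_injOn_dotProduct {A ι : Type*} [Fintype ι] (S : Finset A) (κ : A → ι → ℤ)
    (hκ : Set.InjOn κ S) : ∃ v : ι → ℤ, Set.InjOn (fun a => ∑ i, κ a i * v i) S := by
  classical
  let e := Fintype.equivFin ι
  let p : A → A → Polynomial ℤ := fun a a' =>
    ∑ i, Polynomial.monomial (e i : ℕ) (κ a i - κ a' i)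
  have hp : ∀ a ∈ S, ∀ a' ∈ S, a ≠ a' → p a a' ≠ 0 := by
    intro a ha a' ha' hne h0
    refine hne (hκ ha ha' (funext fun i => ?_))
    have := congrArg (fun q : Polynomial ℤ => q.coeff (e i : ℕ)) h0
    simp only [p, Polynomial.finsetSum_coeff, Polynomial.coeff_monomial,
      Polynomial.coeff_zero] at this
    rw [Finset.sum_eq_single_of_mem i (Finset.mem_univ _)] at this
    · simpa [sub_eq_zero] using this
    · intro j _ hj
      rw [if_neg]
      intro h
      exact hj (e.injective (Fin.ext h))
  let T : Finset (A × A) := (S ×ˢ S).filter fun q => q.1 ≠ q.2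
  have hfin : (⋃ q ∈ T, {x : ℤ | (p q.1 q.2).eval x = 0}).Finite := by
    refine T.finite_toSet.biUnion fun q hq => ?_
    have hq' : q ∈ T := hq
    simp only [T, Finset.mem_filter, Finset.mem_product] at hq'
    have h0 := hp q.1 hq'.1.1 q.2 hq'.1.2 hq'.2
    exact ((p q.1 q.2).roots.toFinset.finite_toSet).subset fun z hz => by simpa [h0] using hz
  obtain ⟨x, hx⟩ := hfin.exists_notMem
  refine ⟨fun i => x ^ (e i : ℕ), fun a ha a' ha' h => ?_⟩
  by_contra hne
  refine hx (Set.mem_biUnion (x := (a, a'))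
    (by simp only [T, Finset.coe_filter, Finset.mem_product]; exact ⟨⟨ha, ha'⟩, hne⟩) ?_)
  simp only [p, Set.mem_ofPred_eq, Polynomial.eval_finsetSum, Polynomial.eval_monomial]
  simp only at h
  rw [← sub_eq_zero, ← Finset.sum_sub_distrib] at h
  rw [← h]
  exact Finset.sum_congr rfl fun i _ => by ring

variable {A ι : Type*} [Fintype ι] (S : Finset A) (b : A → ℂ) (κ : A → ι → ℤ)

instance isProbabilityMeasure_unitAddTorus :
    IsProbabilityMeasure (volume : Measure (UnitAddTorus ι)) :=
  inferInstanceAs (IsProbabilityMeasure (Measure.pi fun _ : ι => (volume : Measure UnitAddCircle)))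

/-- The value of a Laurent polynomial at `e^{-y + 2 π i t}`. -/
noncomputable def torusEval (y : ι → ℝ) (t : UnitAddTorus ι) : ℂ :=
  ∑ a ∈ S, b a * Complex.exp ((-∑ i, κ a i * y i : ℝ) : ℂ) * UnitAddTorus.mFourier (κ a) t

/-- The mean value of the logarithm of a Laurent polynomial on the torus of points
`e^{-y + 2 π i t}`. -/
noncomputable def torusMean (y : ι → ℝ) : ℝ :=
  ∫ t : UnitAddTorus ι, Real.log ‖torusEval S b κ y t‖

/-- The coefficients of the restriction of a Laurent polynomial to a one-parameter subgroup. -/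
noncomputable def sliceCoeff (y : ι → ℝ) (t : UnitAddTorus ι) (a : A) : ℂ :=
  b a * Complex.exp ((-∑ i, κ a i * y i : ℝ) : ℂ) * UnitAddTorus.mFourier (κ a) t

/-- Translation by a one-parameter subgroup. -/
def torusShift (v : ι → ℤ) (p : UnitAddTorus ι × UnitAddCircle) : UnitAddTorus ι :=
  fun i => p.1 i + v i • p.2

omit [Fintype ι] in
theorem continuous_torusShift (v : ι → ℤ) : Continuous (torusShift v) := by
  unfold torusShift
  fun_prop

/-- For fixed `s` this is a translation of the torus, so Haar measure is preserved fibrewise. It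
lets a mean over the torus be computed as a mean of circle means. -/
theorem measurePreserving_torusShift (v : ι → ℤ) :
    MeasurePreserving (torusShift v) (volume.prod volume) volume := by
  have hc : Continuous fun p : UnitAddCircle × UnitAddTorus ι => torusShift v (p.2, p.1) :=
    (continuous_torusShift v).comp continuous_swap
  have h1 : MeasurePreserving (fun p : UnitAddCircle × UnitAddTorus ι =>
      (p.1, torusShift v (p.2, p.1))) (volume.prod volume) (volume.prod volume) := by
    refine MeasurePreserving.skew_product (f := id)
      (g := fun s t => torusShift v (t, s)) (MeasurePreserving.id _) hc.measurable ?_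
    refine ae_of_all _ fun s => ?_
    exact (measurePreserving_add_right volume (fun i => v i • s : UnitAddTorus ι)).map_eq
  have h2 := (measurePreserving_snd (μ := (volume : Measure UnitAddCircle))
    (ν := (volume : Measure (UnitAddTorus ι)))).comp h1
  exact h2.comp Measure.measurePreserving_swap

theorem continuous_torusEval :
    Continuous fun p : (ι → ℝ) × UnitAddTorus ι => torusEval S b κ p.1 p.2 := by
  unfold torusEval
  refine continuous_finsetSum _ fun a _ => ?_
  refine Continuous.mul (by fun_prop) ((UnitAddTorus.mFourier (κ a)).continuous.comp
    continuous_snd)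

theorem continuous_torusEval_right (y : ι → ℝ) :
    Continuous fun t : UnitAddTorus ι => torusEval S b κ y t := by
  unfold torusEval
  exact continuous_finsetSum _ fun a _ => continuous_const.mul (UnitAddTorus.mFourier (κ a)).continuous

theorem measurable_log_torusEval (y : ι → ℝ) :
    Measurable fun t : UnitAddTorus ι => Real.log ‖torusEval S b κ y t‖ :=
  Real.measurable_log.comp (continuous_torusEval_right S b κ y).norm.measurable

theorem mFourier_torusShift (k v : ι → ℤ) (t : UnitAddTorus ι) (s : UnitAddCircle) :
    UnitAddTorus.mFourier k (torusShift v (t, s))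
      = UnitAddTorus.mFourier k t * (fourier 1 s : ℂ) ^ (∑ i, k i * v i) := by
  simp only [UnitAddTorus.mFourier, ContinuousMap.coe_mk, torusShift]
  have h1 : ∀ i, (fourier (k i) (t i + v i • s) : ℂ)
      = fourier (k i) (t i) * (fourier 1 s : ℂ) ^ (k i * v i) := by
    intro i
    rw [fourier_apply, fourier_apply, fourier_one, smul_add, AddCircle.toCircle_add, smul_smul,
      AddCircle.toCircle_zsmul, AddCircle.toCircle_zsmul, Circle.coe_mul, Circle.coe_zpow,
      Circle.coe_zpow]
  simp only [h1, Finset.prod_mul_distrib]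
  congr 1
  have hne : (fourier 1 s : ℂ) ≠ 0 := by rw [fourier_one]; exact Circle.coe_ne_zero _
  have : ∀ T : Finset ι, ∏ i ∈ T, (fourier 1 s : ℂ) ^ (k i * v i)
      = (fourier 1 s : ℂ) ^ ∑ i ∈ T, k i * v i := by
    classical
    intro T
    induction T using Finset.induction_on with
    | empty => simp
    | insert i T hi ih => rw [Finset.prod_insert hi, Finset.sum_insert hi, zpow_add₀ hne, ih]
  exact this _

/-- Moving the modulus by `τ` and the argument by `s` along `v` amounts to evaluating the
one-variable slice at the point of modulus `e^{-τ}` and argument `2 π s`. -/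
theorem torusEval_shift (v : ι → ℤ) (y : ι → ℝ) (τ : ℝ) (t : UnitAddTorus ι) (s : UnitAddCircle) :
    torusEval S b κ (fun i => y i + τ * v i) (torusShift v (t, s))
      = laurentEval S (sliceCoeff b κ y t) (fun a => ∑ i, κ a i * v i)
        (polar (Real.exp (-τ)) s) := by
  rw [torusEval, laurentEval]
  refine Finset.sum_congr rfl fun a _ => ?_
  rw [mFourier_torusShift, sliceCoeff, polar, mul_zpow]
  have h1 : ((Real.exp (-τ) : ℝ) : ℂ) ^ (∑ i, κ a i * v i)
      = Complex.exp ((-τ * (∑ i, κ a i * v i : ℤ) : ℝ) : ℂ) := by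
    rw [Complex.ofReal_exp, ← Complex.exp_int_mul]
    congr 1
    push_cast
    ring
  rw [h1]
  have h2 : (-∑ i, (κ a i : ℝ) * (y i + τ * v i) : ℝ)
      = -∑ i, (κ a i : ℝ) * y i + -τ * (∑ i, κ a i * v i : ℤ) := by
    push_cast
    rw [Finset.mul_sum, ← Finset.sum_neg_distrib, ← Finset.sum_neg_distrib,
      ← Finset.sum_add_distrib]
    exact Finset.sum_congr rfl fun i _ => by ring
  rw [h2, Complex.ofReal_add, Complex.exp_add]
  ring

variable {S b κ}

/-- The bound depends on neither the base point nor the orbit, which makes all slice estimates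
uniform. -/
theorem exists_slope_bound (S : Finset A) (κ : A → ι → ℤ) (v : ι → ℤ) :
    ∃ N : ℕ, ∀ a ∈ S, |∑ i, κ a i * v i| ≤ N := by
  refine ⟨∑ a ∈ S, (∑ i, κ a i * v i).natAbs, fun a ha => ?_⟩
  rw [Int.abs_eq_natAbs]
  exact_mod_cast Finset.single_le_sum (f := fun a => (∑ i, κ a i * v i).natAbs)
    (fun _ _ => Nat.zero_le _) ha

theorem norm_sliceCoeff (y : ι → ℝ) (t : UnitAddTorus ι) (a : A) :
    ‖sliceCoeff b κ y t a‖ = ‖b a‖ * Real.exp (-∑ i, κ a i * y i) := by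
  have : ‖UnitAddTorus.mFourier (κ a) t‖ = 1 := by
    simp only [UnitAddTorus.mFourier, ContinuousMap.coe_mk, norm_prod, fourier_apply,
      Circle.norm_coe, Finset.prod_const_one]
  rw [sliceCoeff, norm_mul, norm_mul, this, mul_one, Complex.norm_exp, Complex.ofReal_re]

theorem torusEval_slice (v : ι → ℤ) (y : ι → ℝ) (t : UnitAddTorus ι) (s : UnitAddCircle) :
    torusEval S b κ y (torusShift v (t, s))
      = laurentEval S (sliceCoeff b κ y t) (fun a => ∑ i, κ a i * v i)
        (polar (Real.exp (-0)) s) := by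
  rw [← torusEval_shift]
  simp

theorem norm_torusEval_le (y : ι → ℝ) (t : UnitAddTorus ι) :
    ‖torusEval S b κ y t‖ ≤ ∑ a ∈ S, ‖b a‖ * Real.exp (-∑ i, κ a i * y i) :=
  (norm_sum_le _ _).trans (Finset.sum_le_sum fun a _ => (norm_sliceCoeff y t a).le)

/-- Along a direction separating the exponents no cancellation occurs, so every slice is a nonzero
Laurent polynomial and vanishes at finitely many points of the circle. Fubini concludes. -/
theorem ae_torusEval_ne_zero (hκ : Set.InjOn κ S) {a : A} (ha : a ∈ S) (hb : b a ≠ 0)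
    (y : ι → ℝ) : ∀ᵐ t : UnitAddTorus ι, torusEval S b κ y t ≠ 0 := by
  obtain ⟨v, hv⟩ := exists_injOn_dotProduct S κ hκ
  obtain ⟨N, hN⟩ := exists_slope_bound S κ v
  have hc := continuous_torusEval_right S b κ y
  have hm : MeasurableSet {t | torusEval S b κ y t ≠ 0} :=
    (isOpen_ne_fun hc continuous_const).measurableSet
  have hmp := measurePreserving_torusShift v
  have hm' : MeasurableSet {p : UnitAddTorus ι × UnitAddCircle |
      torusEval S b κ y (torusShift v p) ≠ 0} := hmp.measurable hm
  have h1 : ∀ᵐ p : UnitAddTorus ι × UnitAddCircle ∂(volume.prod volume),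
      torusEval S b κ y (torusShift v p) ≠ 0 := by
    rw [Measure.ae_prod_iff_ae_ae hm']
    refine ae_of_all _ fun t => ?_
    have hne : sliceCoeff b κ y t a ≠ 0 := by
      rw [← norm_pos_iff, norm_sliceCoeff]
      exact mul_pos (norm_pos_iff.2 hb) (Real.exp_pos _)
    have h2 := ae_laurentEval_ne_zero (β := sliceCoeff b κ y t) (n := fun a => ∑ i, κ a i * v i) hN hv ha hne 0
    filter_upwards [h2] with s hs
    rw [torusEval_slice]
    exact hs
  rw [← hmp.map_eq]
  exact (ae_map_iff hmp.measurable.aemeasurable hm).2 h1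

end Torus

section Torus

variable {A ι : Type*} [Fintype ι] {S : Finset A} {b : A → ℂ} {κ : A → ι → ℤ}

/-- Converts an upper bound on `‖z‖` and a lower bound on the mean of the logarithm into a bound on
the mean of its absolute value. -/
theorem abs_log_norm_le {z : ℂ} {B : ℝ} (h : ‖z‖ ≤ B) :
    |Real.log ‖z‖| ≤ 2 * max (Real.log B) 0 - Real.log ‖z‖ := by
  rcases eq_or_ne z 0 with rfl | hz
  · simp
  · have h1 : Real.log ‖z‖ ≤ max (Real.log B) 0 :=
      (Real.log_le_log (norm_pos_iff.2 hz) h).trans (le_max_left _ _)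
    have h2 := le_max_right (Real.log B) 0
    rcases abs_cases (Real.log ‖z‖) with h3 | h3 <;> linarith

/-- By Tonelli it suffices to bound the `L¹` norms of the slices uniformly. The triangle inequality
bounds the logarithm from above by `log B`, and Mahler's inequality bounds its mean from below; `D`
combines the two. -/
theorem integrable_log_torusEval (hκ : Set.InjOn κ S) {a : A} (ha : a ∈ S) (hb : b a ≠ 0)
    (y : ι → ℝ) : Integrable fun t : UnitAddTorus ι => Real.log ‖torusEval S b κ y t‖ := by
  obtain ⟨v, hv⟩ := exists_injOn_dotProduct S κ hκ
  obtain ⟨N, hN⟩ := exists_slope_bound S κ v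
  have hmp := measurePreserving_torusShift v
  have hm := measurable_log_torusEval S b κ y
  refine ⟨hm.aestronglyMeasurable, ?_⟩
  set B := ∑ a ∈ S, ‖b a‖ * Real.exp (-∑ i, κ a i * y i) with hB
  set D := 2 * max (Real.log B) 0 + (2 * N * Real.log 2
    - Real.log (‖b a‖ * Real.exp (-∑ i, κ a i * y i))) with hD
  have hslice : ∀ t : UnitAddTorus ι, ∫⁻ s : UnitAddCircle,
      ‖Real.log ‖torusEval S b κ y (torusShift v (t, s))‖‖ₑ ≤ ENNReal.ofReal D := by
    intro t
    have hint := integrable_log_norm_laurentEval (β := sliceCoeff b κ y t) hN 0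
    simp_rw [torusEval_slice]
    rw [← ofReal_integral_norm_eq_lintegral_enorm hint]
    refine ENNReal.ofReal_le_ofReal ?_
    have h1 : ∀ s : UnitAddCircle, ‖Real.log ‖laurentEval S (sliceCoeff b κ y t)
        (fun a => ∑ i, κ a i * v i) (polar (Real.exp (-0)) s)‖‖
        ≤ 2 * max (Real.log B) 0 - Real.log ‖laurentEval S (sliceCoeff b κ y t)
        (fun a => ∑ i, κ a i * v i) (polar (Real.exp (-0)) s)‖ := by
      intro s
      rw [Real.norm_eq_abs, ← torusEval_slice]
      exact abs_log_norm_le (norm_torusEval_le y _)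
    refine (integral_mono hint.norm ((integrable_const _).sub hint) h1).trans ?_
    have hne : sliceCoeff b κ y t a ≠ 0 := by
      rw [← norm_pos_iff, norm_sliceCoeff]
      exact mul_pos (norm_pos_iff.2 hb) (Real.exp_pos _)
    have h2 := log_norm_le_laurentMean hN hv ha hne
    rw [norm_sliceCoeff, laurentMean] at h2
    rw [integral_sub' (integrable_const _) hint]
    simp only [integral_const, probReal_univ, one_smul]
    linarith
  have hmeas : Measurable fun p : UnitAddTorus ι × UnitAddCircle =>
      ‖Real.log ‖torusEval S b κ y (torusShift v p)‖‖ₑ := hm.enorm.comp hmp.measurable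
  rw [hasFiniteIntegral_iff_enorm, ← hmp.lintegral_comp hm.enorm,
    lintegral_prod _ hmeas.aemeasurable]
  refine (lintegral_mono hslice).trans_lt ?_
  simp

theorem integrable_log_torusEval_shift (hκ : Set.InjOn κ S) {a : A} (ha : a ∈ S) (hb : b a ≠ 0)
    (v : ι → ℤ) (y : ι → ℝ) : Integrable (fun p : UnitAddTorus ι × UnitAddCircle =>
      Real.log ‖torusEval S b κ y (torusShift v p)‖) (volume.prod volume) :=
  ((measurePreserving_torusShift v).integrable_comp
    (measurable_log_torusEval S b κ y).aestronglyMeasurable).2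
    (integrable_log_torusEval hκ ha hb y)

theorem integrable_laurentMean (hκ : Set.InjOn κ S) {a : A} (ha : a ∈ S) (hb : b a ≠ 0)
    (v : ι → ℤ) (y : ι → ℝ) (τ : ℝ) : Integrable fun t : UnitAddTorus ι =>
      laurentMean S (sliceCoeff b κ y t) (fun a => ∑ i, κ a i * v i) τ := by
  have h := (integrable_log_torusEval_shift hκ ha hb v (fun i => y i + τ * v i)).integral_prod_left
  simp_rw [torusEval_shift] at h
  exact h

/-- The main reduction: as a function of `τ`, the mean over the torus is an average of one-variable
means, each known by Jensen's formula. -/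
theorem torusMean_shift (hκ : Set.InjOn κ S) {a : A} (ha : a ∈ S) (hb : b a ≠ 0)
    (v : ι → ℤ) (y : ι → ℝ) (τ : ℝ) : torusMean S b κ (fun i => y i + τ * v i)
      = ∫ t : UnitAddTorus ι, laurentMean S (sliceCoeff b κ y t) (fun a => ∑ i, κ a i * v i) τ := by
  have hmp := measurePreserving_torusShift v
  have hm := measurable_log_torusEval S b κ (fun i => y i + τ * v i)
  have h := integral_map (μ := volume.prod volume) hmp.measurable.aemeasurable hm.aestronglyMeasurable
  rw [hmp.map_eq] at h
  rw [torusMean, h, integral_prod _ (integrable_log_torusEval_shift hκ ha hb v _)]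
  simp_rw [torusEval_shift]
  rfl

theorem torusMean_convex_direction (hκ : Set.InjOn κ S) {c : A} (hc : c ∈ S) (hb : b c ≠ 0)
    (v : ι → ℤ) (y : ι → ℝ) (τ τ' : ℝ) {p q : ℝ} (hp : 0 ≤ p) (hq : 0 ≤ q) (hpq : p + q = 1) :
    torusMean S b κ (fun i => y i + (p * τ + q * τ') * v i)
      ≤ p * torusMean S b κ (fun i => y i + τ * v i)
        + q * torusMean S b κ (fun i => y i + τ' * v i) := by
  obtain ⟨N, hN⟩ := exists_slope_bound S κ v
  rw [torusMean_shift hκ hc hb, torusMean_shift hκ hc hb, torusMean_shift hκ hc hb,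
    ← integral_const_mul, ← integral_const_mul, ← integral_add
      ((integrable_laurentMean hκ hc hb v y τ).const_mul p)
      ((integrable_laurentMean hκ hc hb v y τ').const_mul q)]
  exact integral_mono (integrable_laurentMean hκ hc hb v y _)
    (((integrable_laurentMean hκ hc hb v y τ).const_mul p).add
      ((integrable_laurentMean hκ hc hb v y τ').const_mul q))
    fun t => laurentMean_convex hN τ τ' hp hq hpq

theorem torusMean_affine_direction (hκ : Set.InjOn κ S) {c : A} (hc : c ∈ S) (hb : b c ≠ 0)
    (v : ι → ℤ) (y : ι → ℝ) (τ τ' : ℝ) {p q : ℝ} (hp : 0 ≤ p) (hq : 0 ≤ q) (hpq : p + q = 1)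
    (h0 : ∀ x ∈ segment ℝ τ τ', ∀ t : UnitAddTorus ι,
      torusEval S b κ (fun i => y i + x * v i) t ≠ 0) :
    torusMean S b κ (fun i => y i + (p * τ + q * τ') * v i)
      = p * torusMean S b κ (fun i => y i + τ * v i)
        + q * torusMean S b κ (fun i => y i + τ' * v i) := by
  obtain ⟨N, hN⟩ := exists_slope_bound S κ v
  rw [torusMean_shift hκ hc hb, torusMean_shift hκ hc hb, torusMean_shift hκ hc hb,
    ← integral_const_mul, ← integral_const_mul, ← integral_add
      ((integrable_laurentMean hκ hc hb v y τ).const_mul p)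
      ((integrable_laurentMean hκ hc hb v y τ').const_mul q)]
  congr 1
  funext t
  refine laurentMean_affine hN hp hq hpq fun x hx s => ?_
  rw [← torusEval_shift]
  exact h0 x hx _

/-- The constant is uniform in `y`, as required to move one coordinate after another. -/
theorem torusMean_lipschitz_direction (hκ : Set.InjOn κ S) {c : A} (hc : c ∈ S) (hb : b c ≠ 0)
    (v : ι → ℤ) : ∃ C : ℝ, ∀ (y : ι → ℝ) (τ : ℝ),
      |torusMean S b κ (fun i => y i + τ * v i) - torusMean S b κ y| ≤ C * |τ| := by
  obtain ⟨N, hN⟩ := exists_slope_bound S κ v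
  refine ⟨3 * N, fun y τ => ?_⟩
  have h0 := torusMean_shift hκ hc hb v y 0
  simp only [zero_mul, add_zero] at h0
  rw [torusMean_shift hκ hc hb, h0, ← integral_sub (integrable_laurentMean hκ hc hb v y τ)
    (integrable_laurentMean hκ hc hb v y 0), ← Real.norm_eq_abs]
  refine (norm_integral_le_of_norm_le_const (C := 3 * N * |τ|) (ae_of_all _ fun t => ?_)).trans
    (by simp)
  have := laurentMean_lipschitz (β := sliceCoeff b κ y t) hN τ 0
  rwa [sub_zero] at this

/-- Every slice coefficient has modulus `‖b a‖ e^{-⟨κ a, y⟩}` whatever the orbit, so Mahler's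
inequality bounds all slice means from below by the same quantity, with an error independent of `y`.
-/
theorem le_torusMean_add (hκ : Set.InjOn κ S) (hb : ∀ a ∈ S, b a ≠ 0) :
    ∃ C : ℝ, ∀ y : ι → ℝ, ∀ a ∈ S, -∑ i, κ a i * y i ≤ torusMean S b κ y + C := by
  obtain ⟨v, hv⟩ := exists_injOn_dotProduct S κ hκ
  obtain ⟨N, hN⟩ := exists_slope_bound S κ v
  refine ⟨2 * N * Real.log 2 + ∑ a ∈ S, |Real.log ‖b a‖|, fun y a ha => ?_⟩
  have h0 := torusMean_shift hκ ha (hb a ha) v y 0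
  simp only [zero_mul, add_zero] at h0
  have h1 : Real.log (‖b a‖ * Real.exp (-∑ i, κ a i * y i)) - 2 * N * Real.log 2
      ≤ torusMean S b κ y := by
    rw [h0]
    have := integral_mono (μ := (volume : Measure (UnitAddTorus ι)))
      (integrable_const (Real.log (‖b a‖ * Real.exp (-∑ i, κ a i * y i)) - 2 * N * Real.log 2))
      (integrable_laurentMean hκ ha (hb a ha) v y 0) fun t => by
        have hne : sliceCoeff b κ y t a ≠ 0 := by
          rw [← norm_pos_iff, norm_sliceCoeff]
          exact mul_pos (norm_pos_iff.2 (hb a ha)) (Real.exp_pos _)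
        have h2 := log_norm_le_laurentMean hN hv ha hne
        rw [norm_sliceCoeff] at h2
        simp only
        linarith
    simpa using this
  rw [Real.log_mul (norm_ne_zero_iff.2 (hb a ha)) (Real.exp_pos _).ne', Real.log_exp] at h1
  have h3 : |Real.log ‖b a‖| ≤ ∑ a ∈ S, |Real.log ‖b a‖| :=
    Finset.single_le_sum (f := fun a => |Real.log ‖b a‖|) (fun _ _ => abs_nonneg _) ha
  have h4 := neg_le_of_abs_le h3
  linarith

theorem torusMean_le_add (hκ : Set.InjOn κ S) (hb : ∀ a ∈ S, b a ≠ 0) (hS : S.Nonempty) :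
    ∃ C : ℝ, ∀ (y : ι → ℝ) (m : ℝ), (∀ a ∈ S, -∑ i, κ a i * y i ≤ m) →
      torusMean S b κ y ≤ m + C := by
  obtain ⟨c, hc⟩ := hS
  refine ⟨Real.log (∑ a ∈ S, ‖b a‖), fun y m hm => ?_⟩
  have hpos : 0 < ∑ a ∈ S, ‖b a‖ :=
    Finset.sum_pos (fun a ha => norm_pos_iff.2 (hb a ha)) ⟨c, hc⟩
  have h1 := integral_mono_ae (integrable_log_torusEval hκ hc (hb c hc) y)
    (integrable_const (m + Real.log (∑ a ∈ S, ‖b a‖))) (by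
      -- At a zero the default value `log 0 = 0` could exceed the bound, so the zeros are discarded
      -- as a null set.
      filter_upwards [ae_torusEval_ne_zero hκ hc (hb c hc) y] with t ht
      refine (Real.log_le_log (norm_pos_iff.2 ht) ((norm_torusEval_le y t).trans
        (Finset.sum_le_sum fun a ha => mul_le_mul_of_nonneg_left
          (Real.exp_le_exp.2 (hm a ha)) (norm_nonneg _)))).trans (le_of_eq ?_)
      rw [← Finset.sum_mul, Real.log_mul hpos.ne' (Real.exp_pos _).ne', Real.log_exp, add_comm])
  simpa [torusMean] using h1

/-! ### Continuity, convexity and local affinity -/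

theorem continuous_torusMean (hκ : Set.InjOn κ S) {c : A} (hc : c ∈ S) (hb : b c ≠ 0) :
    Continuous (torusMean S b κ) := by
  classical
  have hdir : ∀ i : ι, ∃ C : ℝ, ∀ (y : ι → ℝ) (τ : ℝ),
      |torusMean S b κ (y + Pi.single i τ) - torusMean S b κ y| ≤ C * |τ| := by
    intro i
    obtain ⟨C, hC⟩ := torusMean_lipschitz_direction hκ hc hb (Pi.single i 1)
    refine ⟨C, fun y τ => ?_⟩
    convert hC y τ using 4
    funext j
    by_cases h : j = i
    · subst h; simp
    · simp [h]
  choose C hC using hdir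
  -- Change the coordinates one at a time and add up the directional Lipschitz bounds.
  have hsum : ∀ (y d : ι → ℝ) (T : Finset ι),
      |torusMean S b κ (y + ∑ i ∈ T, Pi.single i (d i)) - torusMean S b κ y|
        ≤ ∑ i ∈ T, C i * |d i| := by
    intro y d T
    induction T using Finset.induction_on with
    | empty => simp
    | insert i T hi ih =>
      rw [Finset.sum_insert hi, Finset.sum_insert hi, add_comm (Pi.single i (d i) : ι → ℝ), ← add_assoc]
      have := hC i (y + ∑ i ∈ T, Pi.single i (d i)) (d i)
      refine (abs_sub_le _ (torusMean S b κ (y + ∑ i ∈ T, Pi.single i (d i))) _).trans ?_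
      linarith
  rw [continuous_iff_continuousAt]
  intro y
  rw [ContinuousAt, tendsto_iff_norm_sub_tendsto_zero]
  have hlim : Tendsto (fun z : ι → ℝ => ∑ i, C i * |z i - y i|) (𝓝 y) (𝓝 0) := by
    have : Continuous fun z : ι → ℝ => ∑ i, C i * |z i - y i| := by fun_prop
    simpa using this.tendsto y
  refine squeeze_zero (fun _ => norm_nonneg _) (fun z => ?_) hlim
  have := hsum y (fun i => z i - y i) Finset.univ
  rw [Finset.univ_sum_single] at this
  rw [Real.norm_eq_abs]
  convert this using 4
  funext i
  simp

omit [Fintype ι] in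
/-- A continuous function on a convex open set is convex if it is so on segments with rational
direction. -/
theorem convexOn_of_rational_directions {U : Set (ι → ℝ)} (hU : Convex ℝ U) (hUo : IsOpen U)
    {g : (ι → ℝ) → ℝ} (hg : Continuous g)
    (h : ∀ y ∈ U, ∀ w : ι → ℚ, (y + fun i => (w i : ℝ)) ∈ U → ∀ p q : ℝ, 0 ≤ p → 0 ≤ q →
      p + q = 1 → g (p • y + q • (y + fun i => (w i : ℝ)))
        ≤ p * g y + q * g (y + fun i => (w i : ℝ))) : ConvexOn ℝ U g := by
  refine ⟨hU, fun y hy z hz p q hp hq hpq => ?_⟩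
  have hd : DenseRange fun w : ι → ℚ => (y + fun i => (w i : ℝ)) := by
    have h1 : DenseRange fun w : ι → ℚ => fun i => (w i : ℝ) :=
      DenseRange.piMap fun _ => Rat.denseRange_cast
    exact ((Homeomorph.addLeft y).surjective.denseRange).comp h1 (Homeomorph.addLeft y).continuous
  have hcl : IsClosed {z : ι → ℝ | g (p • y + q • z) ≤ p * g y + q * g z} :=
    isClosed_le (by fun_prop) (by fun_prop)
  have hsub : U ∩ Set.range (fun w : ι → ℚ => (y + fun i => (w i : ℝ)))
      ⊆ {z : ι → ℝ | g (p • y + q • z) ≤ p * g y + q * g z} := by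
    rintro _ ⟨hw, w, rfl⟩
    exact h y hy w hw p q hp hq hpq
  exact closure_minimal hsub hcl (hd.open_subset_closure_inter hUo hz)

/-- Clearing denominators reduces rational directions to the integral ones, which come from
one-parameter subgroups. -/
theorem exists_int_direction (w : ι → ℚ) :
    ∃ (r : ℝ) (v : ι → ℤ), ∀ i, (w i : ℝ) = r * v i := by
  obtain ⟨D, hD⟩ := IsLocalization.exist_integer_multiples_of_finite (nonZeroDivisors ℤ) w
  choose v hv using hD
  have hD0 : ((D : ℤ) : ℝ) ≠ 0 := by exact_mod_cast nonZeroDivisors.ne_zero D.2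
  refine ⟨((D : ℤ) : ℝ)⁻¹, v, fun i => ?_⟩
  have h1 : ((v i : ℤ) : ℚ) = (D : ℤ) * w i := by simpa using hv i
  have h2 : ((v i : ℤ) : ℝ) = (D : ℤ) * (w i : ℝ) := by exact_mod_cast congrArg (Rat.cast (K := ℝ)) h1
  rw [h2, inv_mul_cancel_left₀ hD0]

theorem convexOn_torusMean (hκ : Set.InjOn κ S) {c : A} (hc : c ∈ S) (hb : b c ≠ 0) :
    ConvexOn ℝ Set.univ (torusMean S b κ) := by
  refine convexOn_of_rational_directions convex_univ isOpen_univ (continuous_torusMean hκ hc hb)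
    fun y _ w _ p q hp hq hpq => ?_
  obtain ⟨r, v, hv⟩ := exists_int_direction w
  have := torusMean_convex_direction hκ hc hb v y 0 r hp hq hpq
  convert this using 2
  · funext i
    simp only [Pi.add_apply, Pi.smul_apply, smul_eq_mul, hv]
    linear_combination (y i) * hpq
  · simp
  · congr 2
    funext i
    simp [hv]

/-- Without zeros over `U`, the mean is affine along each segment of rational direction in `U`, so
minus the mean is convex as well. -/
theorem concaveOn_torusMean (hκ : Set.InjOn κ S) {c : A} (hc : c ∈ S) (hb : b c ≠ 0)
    {U : Set (ι → ℝ)} (hU : Convex ℝ U) (hUo : IsOpen U)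
    (h0 : ∀ y ∈ U, ∀ t : UnitAddTorus ι, torusEval S b κ y t ≠ 0) :
    ConcaveOn ℝ U (torusMean S b κ) := by
  rw [← neg_convexOn_iff]
  refine convexOn_of_rational_directions hU hUo (continuous_torusMean hκ hc hb).neg
    fun y hy w hw p q hp hq hpq => ?_
  obtain ⟨r, v, hv⟩ := exists_int_direction w
  have hyw : (y + fun i => (w i : ℝ)) = fun i => y i + r * v i := by
    funext i; simp [hv]
  have := torusMean_affine_direction hκ hc hb v y 0 r hp hq hpq fun x hx t => by
    obtain ⟨p', q', hp', hq', hpq', rfl⟩ := hx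
    refine h0 _ ?_ t
    convert hU hy hw hp' hq' hpq' using 1
    funext i
    simp only [Pi.add_apply, Pi.smul_apply, smul_eq_mul, hv]
    linear_combination -(y i) * hpq'
  have h1 : p • y + q • (y + fun i => (w i : ℝ)) = fun i => y i + (p * 0 + q * r) * v i := by
    funext i
    simp only [Pi.add_apply, Pi.smul_apply, smul_eq_mul, hv]
    linear_combination (y i) * hpq
  simp only [Pi.neg_apply]
  rw [h1, hyw, this]
  simp only [zero_mul, add_zero]
  linarith

end Torus

/-! ### Affinity over zero-free regions -/

section Affine

/-- A function which is both convex and concave near a point agrees with an affine map there. -/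
theorem exists_affineMap_of_convexOn_concaveOn {E : Type*} [NormedAddCommGroup E]
    [NormedSpace ℝ E] {h : E → ℝ} {x : E} {ε : ℝ} (hε : 0 < ε)
    (h1 : ConvexOn ℝ (Metric.ball x ε) h) (h2 : ConcaveOn ℝ (Metric.ball x ε) h) :
    ∃ g : E →ᵃ[ℝ] ℝ, Set.EqOn h g (Metric.ball x ε) := by
  set φ : E → ℝ := fun v => h (x + v) - h x with hφ
  have hmem : ∀ v : E, ‖v‖ < ε → x + v ∈ Metric.ball x ε := fun v hv => by simpa using hv
  have hcomb : ∀ v w : E, ‖v‖ < ε → ‖w‖ < ε → ∀ p q : ℝ, 0 ≤ p → 0 ≤ q → p + q = 1 →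
      φ (p • v + q • w) = p * φ v + q * φ w := by
    intro v w hv hw p q hp hq hpq
    have e1 := h1.2 (hmem v hv) (hmem w hw) hp hq hpq
    have e2 := h2.2 (hmem v hv) (hmem w hw) hp hq hpq
    have e3 : p • (x + v) + q • (x + w) = x + (p • v + q • w) := by
      rw [smul_add, smul_add, add_add_add_comm, ← add_smul, hpq, one_smul]
    rw [e3] at e1 e2
    simp only [smul_eq_mul] at e1 e2
    simp only [hφ]
    linear_combination le_antisymm e1 e2 + h x * hpq
  have hφ0 : φ 0 = 0 := by simp [hφ]
  have hscale : ∀ v : E, ‖v‖ < ε → ∀ p : ℝ, 0 ≤ p → p ≤ 1 → φ (p • v) = p * φ v := by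
    intro v hv p hp hp1
    have := hcomb v 0 hv (by simpa using hε) p (1 - p) hp (by linarith) (by ring)
    simpa [hφ0] using this
  have hneg : ∀ v : E, ‖v‖ < ε → φ (-v) = -φ v := by
    intro v hv
    have := hcomb v (-v) hv (by simpa using hv) (1 / 2) (1 / 2) (by norm_num) (by norm_num)
      (by norm_num)
    rw [smul_neg, add_neg_cancel, hφ0] at this
    linarith
  have hc0 : ∀ v : E, 0 < ε / (‖v‖ + 1) ∧ ‖(ε / (‖v‖ + 1)) • v‖ < ε := by
    intro v
    have hv : 0 < ‖v‖ + 1 := by positivity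
    refine ⟨by positivity, ?_⟩
    rw [norm_smul, Real.norm_of_nonneg (by positivity), div_mul_eq_mul_div, div_lt_iff₀ hv]
    nlinarith
  -- The homogeneous extension of `φ` to all of `E`: the factor `ε / (‖v‖ + 1)` brings `v` into the
  -- ball, and `key` shows that any other admissible factor gives the same value.
  set L : E → ℝ := fun v => φ ((ε / (‖v‖ + 1)) • v) / (ε / (‖v‖ + 1)) with hL
  have key : ∀ (v : E) (c : ℝ), 0 < c → ‖c • v‖ < ε → φ (c • v) = c * L v := by
    intro v c hc hcv
    obtain ⟨k1, k2⟩ := hc0 v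
    simp only [hL]
    set d := ε / (‖v‖ + 1)
    rcases le_total c d with hcd | hcd
    · have := hscale (d • v) k2 (c / d) (by positivity) ((div_le_one k1).2 hcd)
      rw [smul_smul, div_mul_cancel₀ _ k1.ne'] at this
      rw [this]
      ring
    · have := hscale (c • v) hcv (d / c) (by positivity) ((div_le_one hc).2 hcd)
      rw [smul_smul, div_mul_cancel₀ _ hc.ne'] at this
      rw [this]
      field_simp
  have hadd : ∀ v w : E, L (v + w) = L v + L w := by
    intro v w
    -- Small enough for `2c v` and `2c w` to stay in the ball; their midpoint is `c (v + w)`, so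
    -- midpoint affinity gives additivity.
    set c := ε / (2 * (‖v‖ + ‖w‖ + 1)) with hc
    have hs : 0 < ‖v‖ + ‖w‖ + 1 := by positivity
    have hcpos : 0 < c := by positivity
    have hce : c * (2 * (‖v‖ + ‖w‖ + 1)) = ε := div_mul_cancel₀ _ (by positivity)
    have hv0 := norm_nonneg v
    have hw0 := norm_nonneg w
    have n1 : ‖(2 * c) • v‖ < ε := by
      rw [norm_smul, Real.norm_of_nonneg (by positivity)]
      nlinarith
    have n2 : ‖(2 * c) • w‖ < ε := by
      rw [norm_smul, Real.norm_of_nonneg (by positivity)]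
      nlinarith
    have n3 : ‖c • (v + w)‖ < ε := by
      rw [norm_smul, Real.norm_of_nonneg (by positivity)]
      nlinarith [norm_add_le v w]
    have e := hcomb _ _ n1 n2 (1 / 2) (1 / 2) (by norm_num) (by norm_num) (by norm_num)
    rw [smul_smul, smul_smul, ← mul_assoc, show (1 / 2 : ℝ) * 2 = 1 by norm_num, one_mul,
      ← smul_add, key _ c hcpos n3, key v (2 * c) (by positivity) n1,
      key w (2 * c) (by positivity) n2] at e
    have : c * L (v + w) = c * (L v + L w) := by linarith
    exact mul_left_cancel₀ hcpos.ne' this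
  have hLneg : ∀ v : E, L (-v) = -L v := by
    intro v
    obtain ⟨k1, k2⟩ := hc0 v
    simp only [hL, norm_neg, smul_neg]
    rw [hneg _ k2, neg_div]
  have hpos : ∀ (a : ℝ) (v : E), 0 < a → L (a • v) = a * L v := by
    intro a v ha
    obtain ⟨k1, k2⟩ := hc0 (a • v)
    have e1 := key (a • v) _ k1 k2
    rw [smul_smul] at e1 k2
    rw [key v _ (by positivity) k2, mul_assoc] at e1
    exact (mul_left_cancel₀ k1.ne' e1).symm
  have hL0 : L 0 = 0 := by simp [hL, hφ0]
  have hsmul : ∀ (a : ℝ) (v : E), L (a • v) = a * L v := by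
    intro a v
    rcases lt_trichotomy a 0 with ha | rfl | ha
    · have := hpos (-a) v (by linarith)
      rw [neg_smul, hLneg] at this
      linarith
    · rw [zero_smul, hL0, zero_mul]
    · exact hpos a v ha
  let Λ : E →ₗ[ℝ] ℝ := { toFun := L, map_add' := hadd, map_smul' := hsmul }
  refine ⟨Λ.toAffineMap +
    AffineMap.const ℝ E (h x - L x), fun y hy => ?_⟩
  have hy' : ‖y - x‖ < ε := by rwa [← dist_eq_norm]
  have e := key (y - x) 1 one_pos (by simpa using hy')
  have e2 := hadd (y - x) x
  rw [sub_add_cancel] at e2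
  simp only [hφ, one_smul, one_mul, add_sub_cancel] at e
  change h y = L y + (h x - L x)
  linarith

theorem analyticAt_affineMap {ι : Type*} [Fintype ι] (g : (ι → ℝ) →ᵃ[ℝ] ℝ) (y : ι → ℝ) :
    AnalyticAt ℝ g y := by
  rw [AffineMap.decomp g]
  exact ((LinearMap.toContinuousLinearMap g.linear).analyticAt y).add analyticAt_const

variable {A ι : Type*} [Fintype ι] {S : Finset A} {b : A → ℂ} {κ : A → ι → ℤ}

/-- The torus is compact, so projecting the closed zero locus along it gives a closed set. -/
theorem isOpen_torusEval_ne_zero (S : Finset A) (b : A → ℂ) (κ : A → ι → ℤ) :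
    IsOpen {y : ι → ℝ | ∀ t : UnitAddTorus ι, torusEval S b κ y t ≠ 0} := by
  have h : IsClosed (Prod.fst '' {p : (ι → ℝ) × UnitAddTorus ι | torusEval S b κ p.1 p.2 = 0}) :=
    isClosedMap_fst_of_compactSpace _ (isClosed_eq (continuous_torusEval S b κ) continuous_const)
  convert h.isOpen_compl using 1
  ext y
  simp

/-- The mean value is affine on connected sets over which the Laurent polynomial has no zeros. -/
theorem exists_affineMap_eqOn_torusMean (hκ : Set.InjOn κ S) {c : A} (hc : c ∈ S) (hb : b c ≠ 0)
    {U : Set (ι → ℝ)} (hU : IsPreconnected U)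
    (h0 : ∀ y ∈ U, ∀ t : UnitAddTorus ι, torusEval S b κ y t ≠ 0) :
    ∃ g : (ι → ℝ) →ᵃ[ℝ] ℝ, Set.EqOn (torusMean S b κ) g U := by
  have hloc : ∀ y ∈ U, ∃ g : (ι → ℝ) →ᵃ[ℝ] ℝ, torusMean S b κ =ᶠ[𝓝 y] g := by
    intro y hy
    obtain ⟨ε, hε, hball⟩ := Metric.isOpen_iff.1 (isOpen_torusEval_ne_zero S b κ) y (h0 y hy)
    obtain ⟨g, hg⟩ := exists_affineMap_of_convexOn_concaveOn hε
      ((convexOn_torusMean hκ hc hb).subset (Set.subset_univ _) (convex_ball y ε))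
      (concaveOn_torusMean hκ hc hb (convex_ball y ε) Metric.isOpen_ball hball)
    exact ⟨g, hg.eventuallyEq_of_mem (Metric.ball_mem_nhds y hε)⟩
  rcases U.eq_empty_or_nonempty with rfl | ⟨x, hx⟩
  · exact ⟨0, Set.eqOn_empty _ _⟩
  obtain ⟨g, hg⟩ := hloc x hx
  -- Being locally affine near each point of `U`, the mean is analytic there, and the identity
  -- theorem propagates the germ at `x`.
  refine ⟨g, AnalyticOnNhd.eqOn_of_preconnected_of_eventuallyEq (𝕜 := ℝ) (fun y hy => ?_)
    (fun y _ => analyticAt_affineMap g y) hU hx hg⟩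
  obtain ⟨g', hg'⟩ := hloc y hy
  exact (analyticAt_affineMap g' y).congr hg'.symm

end Affine

/-! ### Newton polytope, recession function and stability set -/

section Convex

variable {M : Type*} [AddCommGroup M]

/-- The pairing as a linear form on `M_ℝ`. -/
noncomputable def pairingLinear (u : NR M) : MR M →ₗ[ℝ] ℝ :=
  LinearMap.liftBaseChange ℝ (AddMonoidHom.toIntLinearMap (show M →+ ℝ from u))

theorem pairing_eq_pairingLinear (x : MR M) (u : NR M) : pairing x u = pairingLinear u x := rfl

theorem pairing_one_tmul (m : M) (u : NR M) : pairing ((1 : ℝ) ⊗ₜ[ℤ] m) u = u m := by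
  rw [pairing, LinearMap.liftBaseChange_tmul, one_smul]
  rfl

theorem pairing_smul_right (x : MR M) (u : NR M) (t : ℝ) : pairing x (t • u) = t * pairing x u := by
  simp only [pairing_eq_pairingLinear]
  induction x using TensorProduct.induction_on with
  | zero => simp
  | tmul a m =>
    simp only [pairingLinear, LinearMap.liftBaseChange_tmul, smul_eq_mul]
    change a * (t * u m) = t * (a * u m)
    ring
  | add x y hx hy => rw [map_add, map_add, hx, hy, mul_add]

theorem continuous_apply_NR (m : M) : Continuous fun u : NR M => u m :=
  (continuous_apply m).comp continuous_induced_dom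

theorem add_smul_apply_NR (v u : NR M) (t : ℝ) (m : M) : (v + t • u) m = v m + t * u m := rfl

variable {K : Type*} [NormedField K] {f : AddMonoidAlgebra K M}

theorem support_nonempty (hf : f ≠ 0) : f.coeff.support.Nonempty := by
  rw [Finsupp.support_nonempty_iff]
  simpa using hf

theorem le_pairing_of_mem_newtonPolytope {u : NR M} {c : ℝ} (hc : ∀ m ∈ f.coeff.support, c ≤ u m)
    {x : MR M} (hx : x ∈ newtonPolytope f) : c ≤ pairing x u := by
  have hconv : Convex ℝ {x : MR M | c ≤ pairingLinear u x} :=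
    convex_halfSpace_ge (pairingLinear u).isLinear c
  refine convexHull_min ?_ hconv hx
  rintro _ ⟨m, hm, rfl⟩
  change c ≤ pairing _ u
  rw [pairing_one_tmul]
  exact hc m hm

/-- A linear form attains its minimum over a convex hull at a generator, so later estimates need
only compare exponents. -/
theorem isLeast_supportFunction (hf : f ≠ 0) (u : NR M) :
    IsLeast ((fun x => pairing x u) '' newtonPolytope f)
      (supportFunction (newtonPolytope f) u) ∧
    (∃ m ∈ f.coeff.support, supportFunction (newtonPolytope f) u = u m) ∧
    ∀ m ∈ f.coeff.support, supportFunction (newtonPolytope f) u ≤ u m := by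
  obtain ⟨m, hm, hmin⟩ := f.coeff.support.exists_min_image (fun m => u m) (support_nonempty hf)
  have h1 : IsLeast ((fun x => pairing x u) '' newtonPolytope f) (u m) := by
    refine ⟨⟨(1 : ℝ) ⊗ₜ[ℤ] m, subset_convexHull ℝ _ ⟨m, hm, rfl⟩, pairing_one_tmul m u⟩, ?_⟩
    rintro _ ⟨x, hx, rfl⟩
    exact le_pairing_of_mem_newtonPolytope hmin hx
  have h2 : supportFunction (newtonPolytope f) u = u m := h1.csInf_eq
  rw [h2]
  exact ⟨h1, ⟨m, hm, rfl⟩, hmin⟩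

/-- The support function at `v₀ + t • u` differs from `t` times its value at `u` by at most `D`, the
sum of the `|v₀ m|`. The total error `C + D` disappears after division by `t`. -/
theorem isRecessionFunction_of_bounded (hf : f ≠ 0) {g : NR M → ℝ} {C : ℝ}
    (hC : ∀ u, |g u - supportFunction (newtonPolytope f) u| ≤ C) :
    IsRecessionFunction g (supportFunction (newtonPolytope f)) := by
  intro v₀ u
  set D := ∑ m ∈ f.coeff.support, |v₀ m| with hD
  have hDm : ∀ m ∈ f.coeff.support, |v₀ m| ≤ D := fun m hm =>
    Finset.single_le_sum (f := fun m => |v₀ m|) (fun _ _ => abs_nonneg _) hm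
  have hbound : ∀ t : ℝ, 0 < t →
      |g (v₀ + t • u) / t - supportFunction (newtonPolytope f) u| ≤ (C + D) / t := by
    intro t ht
    obtain ⟨-, ⟨m, hm, hm'⟩, hle⟩ := isLeast_supportFunction hf (v₀ + t • u)
    obtain ⟨-, ⟨l, hl, hl'⟩, hle'⟩ := isLeast_supportFunction hf u
    have e1 := hle l hl
    rw [add_smul_apply_NR, ← hl'] at e1
    rw [add_smul_apply_NR] at hm'
    have e2 := mul_le_mul_of_nonneg_left (hle' m hm) ht.le
    have e3 := abs_le.1 (hC (v₀ + t • u))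
    have e4 := abs_le.1 (hDm m hm)
    have e5 := abs_le.1 (hDm l hl)
    rw [div_sub' ht.ne', abs_div, abs_of_pos ht]
    refine div_le_div_of_nonneg_right (abs_le.2 ⟨?_, ?_⟩) ht.le <;> linarith
  have hlim : Tendsto (fun t : ℝ => (C + D) / t) atTop (𝓝 0) :=
    tendsto_const_nhds.div_atTop tendsto_id
  rw [tendsto_iff_norm_sub_tendsto_zero]
  refine squeeze_zero' (Eventually.of_forall fun _ => norm_nonneg _)
    ((eventually_gt_atTop 0).mono fun t ht => ?_)
    hlim
  rw [Real.norm_eq_abs]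
  exact hbound t ht

/-- Hahn–Banach separation of a point from a compact convex set, carried out in coordinates. The
separating form, restricted to the lattice, is the desired `u`. -/
theorem exists_pairing_lt [Module.Free ℤ M] [Module.Finite ℤ M] (hf : f ≠ 0) {x : MR M}
    (hx : x ∉ newtonPolytope f) :
    ∃ u : NR M, pairing x u < supportFunction (newtonPolytope f) u := by
  let B := (Algebra.TensorProduct.basis ℝ (Module.Free.chooseBasis ℤ M)).equivFun
  have hcompact : IsCompact (B.toLinearMap '' newtonPolytope f) := by
    rw [newtonPolytope, LinearMap.image_convexHull]
    exact ((f.coeff.support.finite_toSet.image _).image _).isCompact_convexHull ℝ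
  have hconv : Convex ℝ (B.toLinearMap '' newtonPolytope f) :=
    (convex_convexHull ℝ _).linear_image _
  have hxB : B x ∉ B.toLinearMap '' newtonPolytope f := by
    rintro ⟨z, hz, hzx⟩
    exact hx (B.injective hzx ▸ hz)
  obtain ⟨φ, r, h1, h2⟩ := geometric_hahn_banach_point_closed hconv hcompact.isClosed hxB
  let Φ : MR M →ₗ[ℝ] ℝ := φ.toLinearMap.comp B.toLinearMap
  let u : NR M := AddMonoidHom.mk' (fun m : M => Φ ((1 : ℝ) ⊗ₜ[ℤ] m)) fun m m' => by
    rw [TensorProduct.tmul_add, map_add]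
  have hu : ∀ m, u m = Φ ((1 : ℝ) ⊗ₜ[ℤ] m) := fun _ => rfl
  have hpair : ∀ z : MR M, pairing z u = Φ z := by
    intro z
    rw [pairing_eq_pairingLinear]
    induction z using TensorProduct.induction_on with
    | zero => simp
    | tmul a m =>
      have e : a ⊗ₜ[ℤ] m = a • ((1 : ℝ) ⊗ₜ[ℤ] m) := by
        rw [TensorProduct.smul_tmul', smul_eq_mul, mul_one]
      rw [e, map_smul, map_smul, ← pairing_eq_pairingLinear, pairing_one_tmul, hu]
    | add x y hx hy => rw [map_add, map_add, hx, hy]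
  refine ⟨u, ?_⟩
  obtain ⟨⟨⟨z, hz, hz'⟩, -⟩, -⟩ := isLeast_supportFunction hf u
  rw [← hz']
  simp only [hpair]
  exact h1.trans (h2 _ ⟨z, hz, rfl⟩)

/-- On the polytope `⟨x, u⟩ - g u` is at least `-C`. Outside it, a separating `u` drives this
difference to `-∞` along the ray `t • u`. -/
theorem stabilitySet_of_bounded [Module.Free ℤ M] [Module.Finite ℤ M] (hf : f ≠ 0)
    {g : NR M → ℝ} {C : ℝ} (hC : ∀ u, |g u - supportFunction (newtonPolytope f) u| ≤ C) :
    stabilitySet g = newtonPolytope f := by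
  ext x
  constructor
  · intro hx
    by_contra hxn
    apply hx
    obtain ⟨u, hu⟩ := exists_pairing_lt hf hxn
    rw [EReal.eq_bot_iff_forall_lt]
    intro r
    set d := supportFunction (newtonPolytope f) u - pairing x u with hd
    have hd0 : 0 < d := sub_pos.2 hu
    -- At `t • u` the difference is at most `C - t * d`, so this `t` brings it below `r`.
    obtain ⟨t, ht, ht0⟩ : ∃ t : ℝ, C - r < t * d ∧ 0 ≤ t := by
      refine ⟨max ((C - r) / d + 1) 0, ?_, le_max_right _ _⟩
      have := mul_le_mul_of_nonneg_right (le_max_left ((C - r) / d + 1) 0) hd0.le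
      rw [add_mul, div_mul_cancel₀ _ hd0.ne'] at this
      linarith
    refine (iInf_le _ (t • u)).trans_lt ?_
    rw [EReal.coe_lt_coe_iff, pairing_smul_right]
    obtain ⟨-, ⟨m, hm, hm'⟩, -⟩ := isLeast_supportFunction hf (t • u)
    obtain ⟨-, -, hle⟩ := isLeast_supportFunction hf u
    have e1 : (t • u) m = t * u m := rfl
    rw [e1] at hm'
    have e2 := mul_le_mul_of_nonneg_left (hle m hm) ht0
    have e3 := abs_le.1 (hC (t • u))
    rw [hd] at ht
    linarith [mul_sub t (supportFunction (newtonPolytope f) u) (pairing x u)]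
  · intro hx
    have hle : ((-C : ℝ) : EReal) ≤ legendreDual g x := by
      refine le_iInf fun u => ?_
      rw [EReal.coe_le_coe_iff]
      have e1 := (isLeast_supportFunction hf u).1.2 ⟨x, hx, rfl⟩
      simp only at e1
      have e2 := abs_le.1 (hC u)
      linarith
    exact ((EReal.bot_lt_coe _).trans_le hle).ne'

/-- The coordinates on `N_ℝ` given by a basis of `M`. -/
noncomputable def coords [Module.Free ℤ M] : NR M →ₗ[ℝ] (BasisIndex M → ℝ) where
  toFun u i := u (Module.Free.chooseBasis ℤ M i)
  map_add' _ _ := rfl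
  map_smul' _ _ := rfl

theorem continuous_coords [Module.Free ℤ M] : Continuous (coords : NR M → BasisIndex M → ℝ) :=
  continuous_pi fun i => continuous_apply_NR (Module.Free.chooseBasis ℤ M i)

theorem apply_eq_sum_coords [Module.Free ℤ M] [Module.Finite ℤ M] (u : NR M) (m : M) :
    u m = ∑ i, ((Module.Free.chooseBasis ℤ M).repr m i : ℝ) * coords u i := by
  conv_lhs => rw [← (Module.Free.chooseBasis ℤ M).sum_repr m]
  rw [map_sum]
  refine Finset.sum_congr rfl fun i _ => ?_
  rw [map_zsmul, zsmul_eq_mul]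
  rfl

end Convex

/-! ### Fibres of the tropicalization and measurability -/

section Fibre

variable {K M : Type*} [NormedField K] [AddCommGroup M]

theorem continuous_eval (f : AddMonoidAlgebra K M) : Continuous fun x : TorusAn K M => x f :=
  (continuous_apply f).comp continuous_induced_dom

theorem trop_eq_iff {x : TorusAn K M} {u : NR M} :
    trop x = u ↔ ∀ m, x (AddMonoidAlgebra.single m 1) = Real.exp (-u m) := by
  have hpos : ∀ m, 0 < x (AddMonoidAlgebra.single m 1) := fun m =>
    lt_of_le_of_ne (apply_nonneg x.toMulRingSeminorm _) (x.apply_single_ne_zero m).symm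
  constructor
  · rintro rfl m
    change _ = Real.exp (-(-Real.log (x (AddMonoidAlgebra.single m 1))))
    rw [neg_neg, Real.exp_log (hpos m)]
  · intro h
    refine DFunLike.ext _ _ fun m => ?_
    change -Real.log (x (AddMonoidAlgebra.single m 1)) = u m
    rw [h, Real.log_exp, neg_neg]

theorem measurableSet_trop_fibre (u : NR M) :
    MeasurableSet (trop ⁻¹' {u} : Set (TorusAn K M)) := by
  have : (trop ⁻¹' {u} : Set (TorusAn K M))
      = ⋂ m, {x | x (AddMonoidAlgebra.single m 1) = Real.exp (-u m)} := by
    ext x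
    simp only [Set.mem_preimage, Set.mem_singleton_iff, trop_eq_iff, Set.mem_iInter,
      Set.mem_ofPred_eq]
  rw [this]
  exact (isClosed_iInter fun m =>
    isClosed_eq (continuous_eval _) continuous_const).measurableSet

theorem measurable_neg_log_eval (f : AddMonoidAlgebra K M) :
    Measurable fun x : TorusAn K M => -Real.log (x f) :=
  (Real.measurable_log.comp (continuous_eval f).measurable).neg

theorem measurableSet_eval_ne_zero (f : AddMonoidAlgebra K M) :
    MeasurableSet {x : TorusAn K M | x f ≠ 0} :=
  (isOpen_ne_fun (continuous_eval f) continuous_const).measurableSet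

end Fibre

/-! ### Archimedean case: translation to means over compact tori -/

section Arch

variable {K M : Type*} [NormedField K] [AddCommGroup M] [CompleteSpace K] [IsAlgClosed K]
  [Module.Free ℤ M] [Module.Finite ℤ M]

/-- The coefficients of a Laurent polynomial over an archimedean field, as complex numbers. -/
noncomputable def archCoeff (h : ¬ IsUltrametricDist K) (f : AddMonoidAlgebra K M) (m : M) : ℂ :=
  (archEquiv h).symm (f.coeff m)

/-- The exponents of the monomials in coordinates. -/
noncomputable def exponent (m : M) (i : BasisIndex M) : ℤ := (Module.Free.chooseBasis ℤ M).repr m i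

/-- The coordinates on `N_ℝ`, rescaled by the exponent of the absolute value. -/
noncomputable def archCoords (h : ¬ IsUltrametricDist K) : NR M →ₗ[ℝ] (BasisIndex M → ℝ) :=
  (archExponent h)⁻¹ • coords

omit [Module.Finite ℤ M] in
theorem injective_exponent : Function.Injective (exponent : M → BasisIndex M → ℤ) :=
  fun _ _ h => (Module.Free.chooseBasis ℤ M).repr.injective (DFunLike.coe_injective h)

omit [AddCommGroup M] [Module.Free ℤ M] [Module.Finite ℤ M] in
theorem archCoeff_ne_zero (h : ¬ IsUltrametricDist K) {f : AddMonoidAlgebra K M} {m : M}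
    (hm : m ∈ f.coeff.support) : archCoeff h f m ≠ 0 := by
  rw [archCoeff, Ne, map_eq_zero_iff _ (archEquiv h).symm.injective]
  exact Finsupp.mem_support_iff.1 hm

theorem sum_exponent_mul_archCoords (h : ¬ IsUltrametricDist K) (u : NR M) (m : M) :
    ∑ i, (exponent m i : ℝ) * archCoords h u i = u m / archExponent h := by
  rw [apply_eq_sum_coords u m, Finset.sum_div]
  refine Finset.sum_congr rfl fun i _ => ?_
  simp only [archCoords, LinearMap.smul_apply, Pi.smul_apply, smul_eq_mul, exponent]
  ring

omit [Module.Finite ℤ M] in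
theorem continuous_archCoords (h : ¬ IsUltrametricDist K) :
    Continuous (archCoords h : NR M → BasisIndex M → ℝ) := by
  have : (archCoords h : NR M → BasisIndex M → ℝ)
      = fun u => (archExponent h)⁻¹ • coords u := rfl
  rw [this]
  exact (continuous_coords (M := M)).const_smul ((archExponent h)⁻¹)

theorem archPoint_apply (h : ¬ IsUltrametricDist K) (u : NR M) (t : UnitAddTorus (BasisIndex M))
    (f : AddMonoidAlgebra K M) : archPoint h u t f
      = ‖torusEval f.coeff.support (archCoeff h f) exponent (archCoords h u) t‖
          ^ archExponent h := by
  rw [← norm_archEquiv, torusEval, map_sum]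
  change ‖AddMonoidAlgebra.lift K K M _ f‖ = _
  rw [AddMonoidAlgebra.lift_apply, Finsupp.sum]
  congr 1
  refine Finset.sum_congr rfl fun m _ => ?_
  rw [map_mul, map_mul, sum_exponent_mul_archCoords, ← neg_div, smul_eq_mul, mul_assoc, archCoeff,
    RingEquiv.apply_symm_apply, ← map_mul]
  rfl

/-- Valid at zeros too, where both logarithms take the default value `0`. -/
theorem neg_log_archPoint (h : ¬ IsUltrametricDist K) (u : NR M)
    (t : UnitAddTorus (BasisIndex M)) (f : AddMonoidAlgebra K M) :
    -Real.log (archPoint h u t f) = -archExponent h *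
      Real.log ‖torusEval f.coeff.support (archCoeff h f) exponent (archCoords h u) t‖ := by
  rw [archPoint_apply]
  rcases (norm_nonneg (torusEval f.coeff.support (archCoeff h f) exponent
    (archCoords h u) t)).eq_or_lt with h0 | h0
  · rw [← h0, Real.zero_rpow (archExponent_pos h).ne', Real.log_zero, neg_zero, mul_zero]
  · rw [Real.log_rpow h0, neg_mul]

theorem trop_archPoint (h : ¬ IsUltrametricDist K) (u : NR M)
    (t : UnitAddTorus (BasisIndex M)) : trop (archPoint h u t : TorusAn K M) = u := by
  refine trop_eq_iff.2 fun m => ?_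
  change ‖AddMonoidAlgebra.lift K K M _ (AddMonoidAlgebra.single m 1)‖ = _
  rw [AddMonoidAlgebra.lift_single, one_smul]
  change ‖archEquiv h (Complex.exp ((-u m / archExponent h : ℝ) : ℂ) *
          UnitAddTorus.mFourier ((Module.Free.chooseBasis ℤ M).repr m) t)‖ = _
  have h1 : ‖UnitAddTorus.mFourier ((Module.Free.chooseBasis ℤ M).repr m) t‖ = 1 := by
    simp only [UnitAddTorus.mFourier, ContinuousMap.coe_mk, norm_prod, fourier_apply,
      Circle.norm_coe, Finset.prod_const_one]
  rw [norm_archEquiv, norm_mul, h1, mul_one, Complex.norm_exp, Complex.ofReal_re,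
    ← Real.exp_mul, div_mul_cancel₀ _ (archExponent_pos h).ne']

theorem continuous_archPoint (h : ¬ IsUltrametricDist K) (u : NR M) :
    Continuous (archPoint h u : UnitAddTorus (BasisIndex M) → TorusAn K M) := by
  refine continuous_induced_rng.2 (continuous_pi fun f => ?_)
  change Continuous fun t => archPoint h u t f
  simp only [archPoint_apply]
  exact (continuous_torusEval_right _ _ _ _).norm.rpow_const
    fun _ => Or.inr (archExponent_pos h).le

theorem fibreMeasure_of_arch (h : ¬ IsUltrametricDist K) (u : NR M) :
    fibreMeasure (K := K) u
      = (volume : Measure (UnitAddTorus (BasisIndex M))).map (archPoint h u) := by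
  rw [fibreMeasure, dif_neg h]

theorem restrict_fibreMeasure_of_arch (h : ¬ IsUltrametricDist K) (u : NR M) :
    (fibreMeasure (K := K) u).restrict (trop ⁻¹' {u})
      = (volume : Measure (UnitAddTorus (BasisIndex M))).map (archPoint h u) := by
  rw [fibreMeasure_of_arch h]
  refine Measure.restrict_eq_self_of_ae_mem ?_
  exact (ae_map_iff (continuous_archPoint h u).measurable.aemeasurable
    (measurableSet_trop_fibre u)).2 (ae_of_all _ fun t => trop_archPoint h u t)

variable {f : AddMonoidAlgebra K M}

theorem ae_ne_zero_of_arch (h : ¬ IsUltrametricDist K) (hf : f ≠ 0) (u : NR M) :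
    ∀ᵐ x ∂(fibreMeasure (K := K) u), x f ≠ 0 := by
  obtain ⟨m, hm⟩ := support_nonempty hf
  rw [fibreMeasure_of_arch h, ae_map_iff (continuous_archPoint h u).measurable.aemeasurable
    (measurableSet_eval_ne_zero f)]
  filter_upwards [ae_torusEval_ne_zero injective_exponent.injOn hm (archCoeff_ne_zero h hm)
    (archCoords h u)] with t ht
  rw [archPoint_apply]
  exact (Real.rpow_pos_of_pos (norm_pos_iff.2 ht) _).ne'

theorem integrableOn_of_arch (h : ¬ IsUltrametricDist K) (hf : f ≠ 0) (u : NR M) :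
    IntegrableOn (fun x : TorusAn K M => -Real.log (x f)) (trop ⁻¹' {u}) (fibreMeasure u) := by
  obtain ⟨m, hm⟩ := support_nonempty hf
  rw [IntegrableOn, restrict_fibreMeasure_of_arch h,
    integrable_map_measure (measurable_neg_log_eval f).aestronglyMeasurable
      (continuous_archPoint h u).measurable.aemeasurable]
  refine ((integrable_log_torusEval injective_exponent.injOn hm (archCoeff_ne_zero h hm)
    (archCoords h u)).const_mul (-archExponent h)).congr (ae_of_all _ fun t => ?_)
  exact (neg_log_archPoint h u t f).symm

theorem ronkin_of_arch (h : ¬ IsUltrametricDist K) (f : AddMonoidAlgebra K M) :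
    ronkin f = fun u => -archExponent h *
      torusMean f.coeff.support (archCoeff h f) exponent (archCoords h u) := by
  funext u
  rw [ronkin, restrict_fibreMeasure_of_arch h,
    integral_map (continuous_archPoint h u).measurable.aemeasurable
      (measurable_neg_log_eval f).aestronglyMeasurable, torusMean, ← integral_const_mul]
  simp_rw [neg_log_archPoint]

theorem continuous_ronkin_of_arch (h : ¬ IsUltrametricDist K) (hf : f ≠ 0) :
    Continuous (ronkin f) := by
  obtain ⟨m, hm⟩ := support_nonempty hf
  rw [ronkin_of_arch h]
  exact continuous_const.mul ((continuous_torusMean injective_exponent.injOn hm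
    (archCoeff_ne_zero h hm)).comp (continuous_archCoords h))

theorem concaveOn_ronkin_of_arch (h : ¬ IsUltrametricDist K) (hf : f ≠ 0) :
    ConcaveOn ℝ Set.univ (ronkin f) := by
  obtain ⟨m, hm⟩ := support_nonempty hf
  rw [ronkin_of_arch h]
  have h1 := ((convexOn_torusMean injective_exponent.injOn hm
    (archCoeff_ne_zero h hm)).comp_linearMap (archCoords h)).smul (archExponent_pos h).le
  have h2 := h1.neg
  rw [Set.preimage_univ] at h2
  refine h2.congr fun u _ => ?_
  simp

/-- A zero on the compact torus over `w` is a point of the hypersurface that tropicalizes to `w`;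
off the amoeba there are none. -/
theorem exists_affineMap_of_arch (h : ¬ IsUltrametricDist K) (hf : f ≠ 0) {U : Set (NR M)}
    (hU : IsPreconnected U) (hUf : U ⊆ (amoeba f)ᶜ) :
    ∃ g : NR M →ᵃ[ℝ] ℝ, Set.EqOn (ronkin f) g U := by
  obtain ⟨m, hm⟩ := support_nonempty hf
  obtain ⟨g, hg⟩ := exists_affineMap_eqOn_torusMean injective_exponent.injOn hm
    (archCoeff_ne_zero h hm) (hU.image _ (continuous_archCoords h).continuousOn) (by
      rintro _ ⟨w, hw, rfl⟩ t ht
      refine hUf hw ⟨archPoint h w t, ?_, trop_archPoint h w t⟩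
      change archPoint h w t f = 0
      rw [archPoint_apply, ht, norm_zero, Real.zero_rpow (archExponent_pos h).ne'])
  refine ⟨(-archExponent h) • (g.comp (archCoords h).toAffineMap), fun w hw => ?_⟩
  rw [ronkin_of_arch h]
  simp only
  rw [hg ⟨w, hw, rfl⟩]
  rfl

theorem bounded_of_arch (h : ¬ IsUltrametricDist K) (hf : f ≠ 0) :
    ∃ C : ℝ, ∀ u : NR M, |ronkin f u - supportFunction (newtonPolytope f) u| ≤ C := by
  have hs := archExponent_pos h
  obtain ⟨C₁, h1⟩ := le_torusMean_add (S := f.coeff.support) (b := archCoeff h f) (κ := exponent)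
    injective_exponent.injOn fun m hm => archCoeff_ne_zero h hm
  obtain ⟨C₂, h2⟩ := torusMean_le_add (S := f.coeff.support) (b := archCoeff h f) (κ := exponent)
    injective_exponent.injOn (fun m hm => archCoeff_ne_zero h hm) (support_nonempty hf)
  refine ⟨archExponent h * max C₁ C₂, fun u => ?_⟩
  obtain ⟨-, ⟨m, hm, hm'⟩, hle⟩ := isLeast_supportFunction hf u
  rw [ronkin_of_arch h]
  simp only
  set R := torusMean f.coeff.support (archCoeff h f) exponent (archCoords h u)
  set Ψ := supportFunction (newtonPolytope f) u with hΨ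
  have e1 := h1 (archCoords h u) m hm
  rw [sum_exponent_mul_archCoords, ← hm'] at e1
  -- In rescaled coordinates every monomial exponent is at most `-Ψ / s`; multiplication by `s`
  -- later restores `Ψ`.
  have e2 := h2 (archCoords h u) (-(Ψ / archExponent h)) fun m hm => by
    rw [sum_exponent_mul_archCoords]
    exact neg_le_neg (div_le_div_of_nonneg_right (hle m hm) hs.le)
  have e3 : Ψ = archExponent h * (Ψ / archExponent h) := (mul_div_cancel₀ _ hs.ne').symm
  have e4 := mul_le_mul_of_nonneg_left (e1.trans (add_le_add_right (le_max_left C₁ C₂) R)) hs.le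
  have e5 := mul_le_mul_of_nonneg_left
    (e2.trans (add_le_add_right (le_max_right C₁ C₂) _)) hs.le
  rw [abs_le]
  constructor <;> linarith

end Arch

/-! ### Extension of valuations -/

section Extension

universe v

/-- A non-trivially valued ultrametric field embeds isometrically in a valued algebraically closed
field. -/
theorem exists_isAlgClosed_of_nontriviallyNormedField {F : Type v} [NontriviallyNormedField F]
    [IsUltrametricDist F] : ∃ (L : Type v) (_ : Field L) (_ : IsAlgClosed L)
      (w : Valuation L ℝ≥0) (i : F →+* L), ∀ x, w (i x) = ‖x‖₊ := by
  -- Over the completion the spectral norm on an algebraic closure is multiplicative, hence a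
  -- valuation extending the norm.
  let E := UniformSpace.Completion F
  let _ : NontriviallyNormedField E :=
    { (inferInstance : NormedField E) with
      non_trivial := by
        obtain ⟨x, hx⟩ := NontriviallyNormedField.non_trivial (α := F)
        exact ⟨(x : UniformSpace.Completion F), by
          change 1 < ‖(x : UniformSpace.Completion F)‖
          rwa [UniformSpace.Completion.norm_coe]⟩ }
  have _ : IsUltrametricDist E := by
    refine IsUltrametricDist.isUltrametricDist_of_forall_norm_add_le_max_norm fun x y => ?_
    refine UniformSpace.Completion.induction_on₂ (α := F) (β := F)
      (p := fun x y => ‖x + y‖ ≤ max ‖x‖ ‖y‖) x y ?_ fun a b => ?_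
    · exact isClosed_le (by fun_prop) (by fun_prop)
    · rw [← UniformSpace.Completion.coe_add, UniformSpace.Completion.norm_coe,
        UniformSpace.Completion.norm_coe, UniformSpace.Completion.norm_coe]
      exact IsUltrametricDist.norm_add_le_max a b
  have _ : CompleteSpace E := inferInstanceAs (CompleteSpace (UniformSpace.Completion F))
  let w : Valuation (AlgebraicClosure E) ℝ≥0 :=
    { toFun := fun x => ⟨spectralNorm E (AlgebraicClosure E) x, spectralNorm_nonneg x⟩
      map_zero' := NNReal.eq spectralNorm_zero
      map_one' := NNReal.eq spectralNorm_one
      map_mul' := fun x y => NNReal.eq (map_mul (spectralMulAlgNorm E (AlgebraicClosure E)) x y)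
      map_add_le_max' := fun x y =>
        isNonarchimedean_spectralNorm (K := E) (L := AlgebraicClosure E) x y }
  refine ⟨AlgebraicClosure E, inferInstance, inferInstance, w,
    (algebraMap E (AlgebraicClosure E)).comp UniformSpace.Completion.coeRingHom, fun x => ?_⟩
  refine NNReal.eq ?_
  change spectralNorm E (AlgebraicClosure E) (algebraMap E _ (x : UniformSpace.Completion F)) = ‖x‖
  rw [spectralNorm_extends]
  exact UniformSpace.Completion.norm_coe x

/-- A domain with a non-trivial rank one valuation embeds isometrically in a valued algebraically
closed field. -/
theorem exists_isAlgClosed_of_valuation {R : Type v} [CommRing R] [IsDomain R]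
    (ν : Valuation R ℝ≥0) (h0 : ∀ x, ν x = 0 → x = 0) (h1 : ∃ x, 1 < ν x) :
    ∃ (L : Type v) (_ : Field L) (_ : IsAlgClosed L)
      (w : Valuation L ℝ≥0) (i : R →+* L), ∀ x, w (i x) = ν x := by
  have hS : nonZeroDivisors R ≤ ν.supp.primeCompl := fun x hx hx' =>
    nonZeroDivisors.ne_zero hx (h0 x hx')
  let F := FractionRing R
  let μ : Valuation F ℝ≥0 := ν.extendToLocalization hS F
  have hμ : ∀ x : R, μ (algebraMap R F x) = ν x :=
    Valuation.extendToLocalization_apply_map_apply ν hS F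
  let a : AbsoluteValue F ℝ :=
    { toFun := fun x => μ x
      map_mul' := fun x y => by rw [map_mul, NNReal.coe_mul]
      nonneg' := fun x => (μ x).2
      eq_zero' := fun x => by rw [NNReal.coe_eq_zero, map_eq_zero]
      add_le' := fun x y => by
        exact_mod_cast (μ.map_add x y).trans (max_le_add_of_nonneg zero_le zero_le) }
  let _ : NontriviallyNormedField F :=
    { a.toNormedField with
      non_trivial := by
        obtain ⟨x, hx⟩ := h1
        refine ⟨algebraMap R F x, ?_⟩
        change 1 < ((μ (algebraMap R F x) : ℝ≥0) : ℝ)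
        rw [hμ]
        exact_mod_cast hx }
  have hn : ∀ x : F, ‖x‖ = μ x := fun _ => rfl
  have _ : IsUltrametricDist F := by
    refine IsUltrametricDist.isUltrametricDist_of_forall_norm_add_le_max_norm fun x y => ?_
    rw [hn, hn, hn]
    exact_mod_cast μ.map_add x y
  obtain ⟨L, hL, hac, w, i, hi⟩ := exists_isAlgClosed_of_nontriviallyNormedField (F := F)
  refine ⟨L, hL, hac, w, i.comp (algebraMap R F), fun x => ?_⟩
  rw [RingHom.comp_apply, hi, ← hμ]
  rfl

end Extension

/-! ### Roots of absolute value one -/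

section Roots

open Polynomial

variable {L : Type*} [Field L] (w : Valuation L ℝ≥0)

/-- The `i`-th coefficient of `p` is strictly larger than all the other ones. -/
def IsDominant (p : L[X]) (i : ℕ) : Prop := ∀ j, j ≠ i → w (p.coeff j) < w (p.coeff i)

variable {w}

/-- If `w α < 1` the summand `X * p` prevails and the dominant index moves up by one; if `w α > 1`
the summand `α * p` prevails and the index stays. -/
theorem exists_isDominant_X_sub_C_mul {p : L[X]} {i : ℕ} (hp : IsDominant w p i) {α : L}
    (hα : w α ≠ 1) : ∃ k, IsDominant w ((X - C α) * p) k := by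
  have hpos : 0 < w (p.coeff i) := zero_le.trans_lt (hp (i + 1) (by omega))
  have hle : ∀ j, w (p.coeff j) ≤ w (p.coeff i) := fun j => by
    rcases eq_or_ne j i with rfl | h
    · exact le_rfl
    · exact (hp j h).le
  have hcoeff : ∀ j, ((X - C α) * p).coeff j = (X * p).coeff j + -(α * p.coeff j) := fun j => by
    rw [sub_mul, coeff_sub, coeff_C_mul, sub_eq_add_neg]
  have hX : ∀ j, w ((X * p).coeff j) ≤ w (p.coeff i) := by
    rintro (_ | j)
    · rw [coeff_X_mul_zero, map_zero]; exact zero_le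
    · rw [coeff_X_mul]; exact hle j
  rcases hα.lt_or_gt with h | h
  · have hα' : ∀ j, w (-(α * p.coeff j)) < w (p.coeff i) := fun j => by
      rw [Valuation.map_neg, map_mul]
      calc w α * w (p.coeff j) ≤ w α * w (p.coeff i) := mul_le_mul_right (hle j) _
        _ < 1 * w (p.coeff i) := mul_lt_mul_of_pos_right h hpos
        _ = _ := one_mul _
    have htop : w (((X - C α) * p).coeff (i + 1)) = w (p.coeff i) := by
      rw [hcoeff, coeff_X_mul]
      exact w.map_add_eq_of_lt_left (hα' _)
    refine ⟨i + 1, fun j hj => ?_⟩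
    rw [htop, hcoeff]
    refine (w.map_add _ _).trans_lt (max_lt ?_ (hα' j))
    rcases j with _ | j
    · rwa [coeff_X_mul_zero, map_zero]
    · rw [coeff_X_mul]
      exact hp j (by omega)
  · have hlt : w (p.coeff i) < w α * w (p.coeff i) := by
      conv_lhs => rw [← one_mul (w (p.coeff i))]
      exact mul_lt_mul_of_pos_right h hpos
    have htop : w (((X - C α) * p).coeff i) = w α * w (p.coeff i) := by
      rw [hcoeff, w.map_add_eq_of_lt_right, Valuation.map_neg, map_mul]
      rw [Valuation.map_neg, map_mul]
      exact (hX i).trans_lt hlt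
    refine ⟨i, fun j hj => ?_⟩
    rw [htop, hcoeff]
    refine (w.map_add _ _).trans_lt (max_lt ((hX j).trans_lt hlt) ?_)
    rw [Valuation.map_neg, map_mul]
    exact mul_lt_mul_of_pos_left (hp j hj) (zero_lt_one.trans h)

/-- A polynomial none of whose coefficients is dominant has a root of absolute value one. -/
theorem exists_root_of_not_isDominant [IsAlgClosed L] {p : L[X]} (hp : p ≠ 0)
    (h : ∀ i, ¬ IsDominant w p i) : ∃ α, p.eval α = 0 ∧ w α = 1 := by
  by_contra hcon
  push Not at hcon
  -- With no root of absolute value one, a dominant coefficient persists as linear factors are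
  -- multiplied together, starting from the constant `1`.
  have key : ∀ s : Multiset L, (∀ α ∈ s, w α ≠ 1) →
      ∃ k, IsDominant w (s.map fun α => X - C α).prod k := by
    intro s
    induction s using Multiset.induction_on with
    | empty =>
      intro _
      refine ⟨0, fun j hj => ?_⟩
      rw [Multiset.map_zero, Multiset.prod_zero, coeff_one_zero, coeff_one, if_neg hj]
      simp
    | cons α s ih =>
      intro hs
      obtain ⟨k, hk⟩ := ih fun β hβ => hs β (Multiset.mem_cons_of_mem hβ)
      rw [Multiset.map_cons, Multiset.prod_cons]
      exact exists_isDominant_X_sub_C_mul hk (hs α (Multiset.mem_cons_self α s))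
  obtain ⟨k, hk⟩ := key p.roots fun α hα => hcon α (isRoot_of_mem_roots hα)
  refine h k fun j hj => ?_
  rw [(IsAlgClosed.splits p).eq_prod_roots, coeff_C_mul, coeff_C_mul, map_mul, map_mul]
  refine mul_lt_mul_of_pos_left (hk j hj) ?_
  rw [pos_iff_ne_zero, Ne, map_eq_zero]
  exact leadingCoeff_ne_zero.2 hp

end Roots

/-! ### Gauss valuations and orders of monomials -/

section Gauss

variable {K M : Type*} [NormedField K] [AddCommGroup M] [IsUltrametricDist K] [Module.Free ℤ M]

/-- The Gauss norm as a valuation. -/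
noncomputable def gaussValuation (u : NR M) : Valuation (AddMonoidAlgebra K M) ℝ≥0 where
  toFun := gaussNorm u
  map_zero' := by simp [gaussNorm]
  map_one' := by
    rw [AddMonoidAlgebra.one_def, gaussNorm_single]
    simp
  map_mul' f g := gaussNorm_mul u f g
  map_add_le_max' f g := gaussNorm_add_le u f g

omit [IsUltrametricDist K] [Module.Free ℤ M] in
theorem gaussNorm_pos (u : NR M) {f : AddMonoidAlgebra K M} (hf : f ≠ 0) : 0 < gaussNorm u f := by
  obtain ⟨m, hm⟩ := support_nonempty hf
  refine lt_of_lt_of_le ?_ (le_gaussNorm u f m)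
  exact mul_pos (nnnorm_pos.2 (Finsupp.mem_support_iff.1 hm))
    (Real.toNNReal_pos.2 (Real.exp_pos _))

end Gauss

section Monomial

variable {K M : Type*} [NormedField K] [AddCommGroup M]

/-- The value `-log ‖c_m χ^m‖` of the monomial of exponent `m` of `f` over `u`. -/
noncomputable def monomialOrder (f : AddMonoidAlgebra K M) (m : M) (u : NR M) : ℝ :=
  u m - Real.log ‖f.coeff m‖

variable {f : AddMonoidAlgebra K M}

theorem coe_monomial_norm {m : M} (hm : m ∈ f.coeff.support) (u : NR M) :
    ((‖f.coeff m‖₊ * Real.toNNReal (Real.exp (-u m)) : ℝ≥0) : ℝ)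
      = Real.exp (-monomialOrder f m u) := by
  rw [NNReal.coe_mul, coe_nnnorm, Real.coe_toNNReal _ (Real.exp_pos _).le, monomialOrder, neg_sub,
    sub_eq_add_neg, Real.exp_add, Real.exp_log (norm_pos_iff.2 (Finsupp.mem_support_iff.1 hm))]

theorem neg_log_gaussNorm_le {m : M} (hm : m ∈ f.coeff.support) (u : NR M) :
    -Real.log (gaussNorm u f) ≤ monomialOrder f m u := by
  have h1 : Real.exp (-monomialOrder f m u) ≤ gaussNorm u f := by
    rw [← coe_monomial_norm hm]
    exact_mod_cast le_gaussNorm u f m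
  have h2 := Real.log_le_log (Real.exp_pos _) h1
  rw [Real.log_exp] at h2
  linarith

theorem exists_neg_log_gaussNorm_eq (hf : f ≠ 0) (u : NR M) :
    ∃ m ∈ f.coeff.support, -Real.log (gaussNorm u f) = monomialOrder f m u := by
  obtain ⟨m, hm, hm'⟩ := Finset.exists_mem_eq_sup f.coeff.support (support_nonempty hf)
    fun m => ‖f.coeff m‖₊ * Real.toNNReal (Real.exp (-u m))
  refine ⟨m, hm, ?_⟩
  rw [gaussNorm, hm', coe_monomial_norm hm, Real.log_exp, neg_neg]

theorem monomial_norm_eq_gaussNorm (hf : f ≠ 0) {m : M} (hm : m ∈ f.coeff.support) {u : NR M}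
    (h : -Real.log (gaussNorm u f) = monomialOrder f m u) :
    ‖f.coeff m‖₊ * Real.toNNReal (Real.exp (-u m)) = gaussNorm u f := by
  refine NNReal.eq ?_
  rw [coe_monomial_norm hm, ← h, neg_neg, Real.exp_log]
  exact_mod_cast gaussNorm_pos u hf

theorem continuous_monomialOrder (f : AddMonoidAlgebra K M) (m : M) :
    Continuous (monomialOrder f m) :=
  (continuous_apply_NR m).sub continuous_const

end Monomial

/-! ### Non-archimedean case -/

section NonArch

variable {K M : Type*} [NormedField K] [AddCommGroup M] [IsUltrametricDist K]

/-- The Gauss norm is multiplicative and positive off zero. -/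
theorem isDomain_addMonoidAlgebra [Module.Free ℤ M] : IsDomain (AddMonoidAlgebra K M) := by
  have : NoZeroDivisors (AddMonoidAlgebra K M) :=
    { eq_zero_or_eq_zero_of_mul_eq_zero := fun {a b} hab => by
        by_contra hcon
        push Not at hcon
        have h1 := mul_pos (gaussNorm_pos 0 hcon.1) (gaussNorm_pos 0 hcon.2)
        rw [← gaussNorm_mul, hab] at h1
        simp [gaussNorm] at h1 }
  exact NoZeroDivisors.to_isDomain _

/-- If the maximum defining the Gauss norm of `f` is attained at two different exponents then some
point of the hypersurface of `f` tropicalizes to `u`. -/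
theorem mem_amoeba_of_two_maxima [Module.Free ℤ M] [Module.Finite ℤ M] {f : AddMonoidAlgebra K M}
    (hf : f ≠ 0) {u : NR M} {m₁ m₂ : M} (hne : m₁ ≠ m₂)
    (h₁ : ‖f.coeff m₁‖₊ * Real.toNNReal (Real.exp (-u m₁)) = gaussNorm u f)
    (h₂ : ‖f.coeff m₂‖₊ * Real.toNNReal (Real.exp (-u m₂)) = gaussNorm u f) :
    u ∈ amoeba f := by
  -- The extra variable is given Gauss norm `e > 1`. The valuation is thus non-trivial even if `K`
  -- is trivially valued and `u = 0`, so it extends to an algebraically closed field `L`.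
  let u' : NR (M × ℤ) := AddMonoidHom.mk' (fun p => u p.1 - p.2) fun p q => by
    rw [Prod.fst_add, map_add, Prod.snd_add]
    push_cast
    ring
  have hu' : ∀ m : M, u' (m, 0) = u m := fun m => by
    change u m - ((0 : ℤ) : ℝ) = u m
    simp
  have _ : IsDomain (AddMonoidAlgebra K (M × ℤ)) := isDomain_addMonoidAlgebra
  obtain ⟨L, _, _, w, i, hi⟩ := exists_isAlgClosed_of_valuation
    (gaussValuation (K := K) u') (fun x hx => by
      by_contra hx0
      exact (gaussNorm_pos u' hx0).ne' hx) ⟨AddMonoidAlgebra.single (0, 1) 1, by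
      change 1 < gaussNorm u' _
      have e : -u' ((0 : M), (1 : ℤ)) = 1 := by
        change -(u 0 - ((1 : ℤ) : ℝ)) = 1
        rw [map_zero]
        simp
      rw [gaussNorm_single, e, nnnorm_one, one_mul]
      exact Real.one_lt_toNNReal.2 (Real.one_lt_exp_iff.2 one_pos)⟩
  replace hi : ∀ x, w (i x) = gaussNorm u' x := hi
  have hsingle : ∀ (m : M) (c : K), w (i (AddMonoidAlgebra.single (m, 0) c))
      = ‖c‖₊ * Real.toNNReal (Real.exp (-u m)) := fun m c => by
    rw [hi, gaussNorm_single, hu']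
  -- A coordinate separating the two maximal exponents; `f` will be viewed as a polynomial in it.
  obtain ⟨j, hj⟩ : ∃ j, exponent m₁ j ≠ exponent m₂ j := by
    by_contra hcon
    push Not at hcon
    exact hne (injective_exponent (funext hcon))
  obtain ⟨N, hN⟩ : ∃ N : ℕ, ∀ m ∈ f.coeff.support, |exponent m j| ≤ N := by
    refine ⟨∑ m ∈ f.coeff.support, (exponent m j).natAbs, fun m hm => ?_⟩
    rw [Int.abs_eq_natAbs]
    exact_mod_cast Finset.single_le_sum (f := fun m => (exponent m j).natAbs)
      (fun _ _ => Nat.zero_le _) hm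
  let d : M → ℕ := fun m => (exponent m j + N).toNat
  have hd : ∀ m ∈ f.coeff.support, ((d m : ℕ) : ℤ) = exponent m j + N := fun m hm =>
    Int.toNat_of_nonneg (by linarith [neg_le_of_abs_le (hN m hm)])
  -- This is `X ^ N` times `f` at the generic point over `u`, with its `j`-th coordinate multiplied
  -- by the unknown `X`. A root of absolute value one moves this point into the hypersurface without
  -- changing its tropicalization.
  let p : Polynomial L := ∑ m ∈ f.coeff.support,
    Polynomial.C (i (AddMonoidAlgebra.single (m, 0) (f.coeff m))) * Polynomial.X ^ d m
  have hcoeff : ∀ k, p.coeff k = i (∑ m ∈ f.coeff.support with d m = k,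
      AddMonoidAlgebra.single (m, 0) (f.coeff m)) := by
    intro k
    rw [map_sum, Finset.sum_filter, Polynomial.finsetSum_coeff]
    refine Finset.sum_congr rfl fun m _ => ?_
    rw [Polynomial.coeff_C_mul, Polynomial.coeff_X_pow]
    by_cases h : k = d m
    · rw [if_pos h, if_pos h.symm, mul_one]
    · rw [if_neg h, if_neg fun h' => h h'.symm, mul_zero]
  have hle : ∀ k, w (p.coeff k) ≤ gaussNorm u f := by
    intro k
    rw [hcoeff, map_sum]
    refine w.map_sum_le fun m _ => ?_
    rw [hsingle]
    exact le_gaussNorm u f m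
  have hge : ∀ m, ‖f.coeff m‖₊ * Real.toNNReal (Real.exp (-u m)) = gaussNorm u f →
      m ∈ f.coeff.support ∧ w (p.coeff (d m)) = gaussNorm u f := by
    intro m hm
    have hms : m ∈ f.coeff.support := by
      rw [Finsupp.mem_support_iff]
      intro h0
      rw [h0, nnnorm_zero, zero_mul] at hm
      exact (gaussNorm_pos u hf).ne hm
    refine ⟨hms, le_antisymm (hle _) ?_⟩
    -- Distinct exponents with the same degree `d m` remain distinct monomials in `K[M × ℤ]`, so
    -- they cannot cancel in the Gauss norm.
    rw [hcoeff, hi]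
    refine le_trans (le_of_eq ?_) (le_gaussNorm u' _ (m, 0))
    rw [hu', ← hm]
    congr 2
    have hmem : m ∈ f.coeff.support.filter fun m' => d m' = d m := Finset.mem_filter.2 ⟨hms, rfl⟩
    rw [AddMonoidAlgebra.coeff_sum, Finsupp.finsetSum_apply, Finset.sum_eq_single_of_mem m hmem]
    · simp
    · intro m' _ hm'
      simp [hm']
  obtain ⟨hs₁, hw₁⟩ := hge m₁ h₁
  obtain ⟨hs₂, hw₂⟩ := hge m₂ h₂
  have hd12 : d m₁ ≠ d m₂ := by
    intro h
    have e1 := hd m₁ hs₁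
    have e2 := hd m₂ hs₂
    rw [h, e2] at e1
    exact hj (by linarith)
  have hp0 : p ≠ 0 := by
    intro h
    rw [h, Polynomial.coeff_zero, map_zero] at hw₁
    exact (gaussNorm_pos u hf).ne hw₁
  -- The coefficients of degrees `d m₁` and `d m₂` both attain the maximum, so none is dominant.
  obtain ⟨α, hα, hα1⟩ := exists_root_of_not_isDominant (w := w) hp0 (by
    intro k hk
    by_cases h : d m₁ = k
    · exact (hk (d m₂) fun h' => hd12 (h.trans h'.symm)).not_ge ((hle k).trans hw₂.ge)
    · exact (hk (d m₁) h).not_ge ((hle k).trans hw₁.ge))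
  have hα0 : α ≠ 0 := by
    rintro rfl
    rw [map_zero] at hα1
    exact zero_ne_one hα1
  let _ : Algebra K L :=
    (i.comp (algebraMap K (AddMonoidAlgebra K (M × ℤ)))).toAlgebra
  have halg : ∀ k : K, algebraMap K L k = i (AddMonoidAlgebra.single 0 k) := fun k => rfl
  let z : Multiplicative M →* L :=
    { toFun := fun m => i (AddMonoidAlgebra.single (m.toAdd, 0) 1) * α ^ exponent m.toAdd j
      map_one' := by
        have e : exponent (0 : M) j = 0 := by simp [exponent]
        rw [toAdd_one, e, zpow_zero, mul_one]
        exact map_one i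
      map_mul' := fun m m' => by
        have e : exponent (m.toAdd + m'.toAdd) j = exponent m.toAdd j + exponent m'.toAdd j := by
          simp [exponent]
        have e' : (AddMonoidAlgebra.single (m.toAdd + m'.toAdd, (0 : ℤ)) 1 :
            AddMonoidAlgebra K (M × ℤ)) = AddMonoidAlgebra.single (m.toAdd, 0) 1
              * AddMonoidAlgebra.single (m'.toAdd, 0) 1 := by
          rw [AddMonoidAlgebra.single_mul_single, one_mul, Prod.mk_add_mk, add_zero]
        rw [toAdd_mul, e, zpow_add₀ hα0, e', map_mul]
        ring }
  let Φ := AddMonoidAlgebra.lift K L M z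
  have hΦ : ∀ (m : M) (c : K), Φ (AddMonoidAlgebra.single m c)
      = i (AddMonoidAlgebra.single (m, 0) c) * α ^ exponent m j := by
    intro m c
    have e : (AddMonoidAlgebra.single (m, (0 : ℤ)) c : AddMonoidAlgebra K (M × ℤ))
        = AddMonoidAlgebra.single 0 c * AddMonoidAlgebra.single (m, 0) 1 := by
      rw [AddMonoidAlgebra.single_mul_single, zero_add, mul_one]
    rw [AddMonoidAlgebra.lift_single, Algebra.smul_def, halg, e, map_mul, mul_assoc]
    rfl
  have hΦf : Φ f = 0 := by
    have e1 : α ^ N * Φ f = p.eval α := by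
      rw [AddMonoidAlgebra.lift_apply, Finsupp.sum, Polynomial.eval_finsetSum, Finset.mul_sum]
      refine Finset.sum_congr rfl fun m hm => ?_
      rw [← AddMonoidAlgebra.lift_single, Polynomial.eval_mul, Polynomial.eval_C,
        Polynomial.eval_pow, Polynomial.eval_X]
      change α ^ N * Φ _ = _
      rw [hΦ, ← zpow_natCast α (d m), hd m hm, zpow_add₀ hα0, zpow_natCast]
      ring
    rw [hα] at e1
    exact (mul_eq_zero.1 e1).resolve_left (pow_ne_zero _ hα0)
  let x : TorusAn K M :=
    { toFun := fun g => w (Φ g)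
      map_zero' := by simp
      add_le' := fun g g' => by
        rw [map_add]
        exact_mod_cast (w.map_add _ _).trans (max_le_add_of_nonneg zero_le zero_le)
      neg' := fun g => by rw [map_neg, Valuation.map_neg]
      map_one' := by simp
      map_mul' := fun g g' => by rw [map_mul, map_mul, NNReal.coe_mul]
      extends_norm := fun k => by
        have hu0 : u 0 = 0 := map_zero u
        rw [AlgHom.commutes, halg]
        change ((w (i (AddMonoidAlgebra.single (0, 0) k)) : ℝ≥0) : ℝ) = _
        rw [hsingle, hu0]
        simp }
  refine ⟨x, ?_, trop_eq_iff.2 fun m => ?_⟩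
  · change ((w (Φ f) : ℝ≥0) : ℝ) = 0
    rw [hΦf, map_zero, NNReal.coe_zero]
  · change ((w (Φ (AddMonoidAlgebra.single m 1)) : ℝ≥0) : ℝ) = _
    rw [hΦ, map_mul, hsingle, map_zpow₀, hα1, one_zpow, mul_one, nnnorm_one, one_mul,
      Real.coe_toNNReal _ (Real.exp_pos _).le]

variable {f : AddMonoidAlgebra K M}

theorem trop_gaussPoint [Module.Free ℤ M] (u : NR M) :
    trop (gaussPoint u : TorusAn K M) = u := by
  refine trop_eq_iff.2 fun m => ?_
  change ((gaussNorm u (AddMonoidAlgebra.single m 1) : ℝ≥0) : ℝ) = _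
  rw [gaussNorm_single, nnnorm_one, one_mul, Real.coe_toNNReal _ (Real.exp_pos _).le]

variable [CompleteSpace K] [IsAlgClosed K] [Module.Free ℤ M] [Module.Finite ℤ M]

theorem fibreMeasure_of_nonarch (u : NR M) :
    fibreMeasure (K := K) u = Measure.dirac (gaussPoint u) := by
  rw [fibreMeasure, dif_pos]

theorem restrict_fibreMeasure_of_nonarch (u : NR M) :
    (fibreMeasure (K := K) u).restrict (trop ⁻¹' {u}) = Measure.dirac (gaussPoint u) := by
  rw [fibreMeasure_of_nonarch]
  refine Measure.restrict_eq_self_of_ae_mem ?_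
  exact (ae_dirac_iff (measurableSet_trop_fibre u)).2 (trop_gaussPoint u)

theorem ae_ne_zero_of_nonarch (hf : f ≠ 0) (u : NR M) :
    ∀ᵐ x ∂(fibreMeasure (K := K) u), x f ≠ 0 := by
  rw [fibreMeasure_of_nonarch, ae_dirac_iff (measurableSet_eval_ne_zero f)]
  change ((gaussNorm u f : ℝ≥0) : ℝ) ≠ 0
  exact_mod_cast (gaussNorm_pos u hf).ne'

theorem integrableOn_of_nonarch (f : AddMonoidAlgebra K M) (u : NR M) :
    IntegrableOn (fun x : TorusAn K M => -Real.log (x f)) (trop ⁻¹' {u}) (fibreMeasure u) := by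
  rw [IntegrableOn, restrict_fibreMeasure_of_nonarch]
  exact integrable_dirac' (measurable_neg_log_eval f).stronglyMeasurable (by simp)

theorem ronkin_of_nonarch (f : AddMonoidAlgebra K M) :
    ronkin f = fun u => -Real.log (gaussNorm u f) := by
  funext u
  rw [ronkin, restrict_fibreMeasure_of_nonarch,
    integral_dirac' _ _ (measurable_neg_log_eval f).stronglyMeasurable]
  rfl

theorem continuous_ronkin_of_nonarch (hf : f ≠ 0) : Continuous (ronkin f) := by
  have h : ronkin f = fun u => f.coeff.support.inf' (support_nonempty hf)
      fun m => monomialOrder f m u := by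
    rw [ronkin_of_nonarch]
    funext u
    obtain ⟨m, hm, hm'⟩ := exists_neg_log_gaussNorm_eq hf u
    refine le_antisymm (Finset.le_inf' _ _ fun m hm => neg_log_gaussNorm_le hm u) ?_
    rw [hm']
    exact Finset.inf'_le (fun m => monomialOrder f m u) hm
  rw [h]
  exact Continuous.finset_inf'_apply _ fun m _ => continuous_monomialOrder f m

theorem concaveOn_ronkin_of_nonarch (hf : f ≠ 0) : ConcaveOn ℝ Set.univ (ronkin f) := by
  rw [ronkin_of_nonarch]
  refine ⟨convex_univ, fun u _ v _ a b ha hb hab => ?_⟩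
  obtain ⟨m, hm, hm'⟩ := exists_neg_log_gaussNorm_eq hf (a • u + b • v)
  have e1 := mul_le_mul_of_nonneg_left (neg_log_gaussNorm_le hm u) ha
  have e2 := mul_le_mul_of_nonneg_left (neg_log_gaussNorm_le hm v) hb
  have e3 : (a • u + b • v) m = a * u m + b * v m := rfl
  simp only [smul_eq_mul]
  rw [hm']
  simp only [monomialOrder] at e1 e2 ⊢
  rw [e3]
  have e4 : Real.log ‖f.coeff m‖ = a * Real.log ‖f.coeff m‖ + b * Real.log ‖f.coeff m‖ := by
    rw [← add_mul, hab, one_mul]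
  linarith

theorem exists_affineMap_of_nonarch (hf : f ≠ 0) {U : Set (NR M)}
    (hU : IsPreconnected U) (hUf : U ⊆ (amoeba f)ᶜ) :
    ∃ g : NR M →ᵃ[ℝ] ℝ, Set.EqOn (ronkin f) g U := by
  classical
  let V : M → Set (NR M) := fun m =>
    {u | ∀ m' ∈ f.coeff.support, m' ≠ m → monomialOrder f m u < monomialOrder f m' u}
  have hVo : ∀ m, IsOpen (V m) := by
    intro m
    have : V m = ⋂ m' ∈ f.coeff.support,
        {u | m' ≠ m → monomialOrder f m u < monomialOrder f m' u} := by
      ext u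
      simp [V]
    rw [this]
    refine isOpen_biInter_finset fun m' _ => ?_
    by_cases h : m' = m
    · simp [h]
    · simp only [ne_eq, h, not_false_eq_true, forall_const]
      exact isOpen_lt (continuous_monomialOrder f m) (continuous_monomialOrder f m')
  have hcover : ∀ u ∈ U, ∃ m ∈ f.coeff.support, u ∈ V m ∧
      -Real.log (gaussNorm u f) = monomialOrder f m u := by
    intro u hu
    obtain ⟨m, hm, hm'⟩ := exists_neg_log_gaussNorm_eq hf u
    refine ⟨m, hm, fun l hl hlm => ?_, hm'⟩
    refine lt_of_le_of_ne (hm' ▸ neg_log_gaussNorm_le hl u) fun heq => ?_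
    exact hUf hu (mem_amoeba_of_two_maxima hf hlm
      (monomial_norm_eq_gaussNorm hf hl (hm'.trans heq)) (monomial_norm_eq_gaussNorm hf hm hm'))
  rcases U.eq_empty_or_nonempty with rfl | ⟨u₀, hu₀⟩
  · exact ⟨0, Set.eqOn_empty _ _⟩
  obtain ⟨m₀, hm₀, hV₀, -⟩ := hcover u₀ hu₀
  have hsub : U ⊆ V m₀ := by
    refine hU.subset_left_of_subset_union (v := ⋃ m ∈ f.coeff.support.erase m₀, V m) (hVo m₀)
      (isOpen_biUnion fun m _ => hVo m) ?_ (fun u hu => ?_) ⟨u₀, hu₀, hV₀⟩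
    · rw [Set.disjoint_left]
      intro u hu hu'
      obtain ⟨m, hm, hum⟩ := Set.mem_iUnion₂.1 hu'
      have hm' := Finset.mem_erase.1 hm
      exact lt_asymm (hu m hm'.2 hm'.1) (hum m₀ hm₀ hm'.1.symm)
    · obtain ⟨m, hm, hum, -⟩ := hcover u hu
      rcases eq_or_ne m m₀ with rfl | h
      · exact Or.inl hum
      · exact Or.inr (Set.mem_iUnion₂.2 ⟨m, Finset.mem_erase.2 ⟨h, hm⟩, hum⟩)
  let Λ : NR M →ₗ[ℝ] ℝ :=
    { toFun := fun u => u m₀, map_add' := fun _ _ => rfl, map_smul' := fun _ _ => rfl }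
  refine ⟨Λ.toAffineMap - AffineMap.const ℝ (NR M) (Real.log ‖f.coeff m₀‖), fun u hu => ?_⟩
  obtain ⟨m, hm, hum, hm'⟩ := hcover u hu
  have hmm : m = m₀ := by
    by_contra h
    exact lt_asymm (hum m₀ hm₀ fun h' => h h'.symm) (hsub hu m hm h)
  rw [ronkin_of_nonarch]
  simp only
  rw [hm', hmm]
  rfl

theorem bounded_of_nonarch (hf : f ≠ 0) :
    ∃ C : ℝ, ∀ u : NR M, |ronkin f u - supportFunction (newtonPolytope f) u| ≤ C := by
  refine ⟨∑ m ∈ f.coeff.support, |Real.log ‖f.coeff m‖|, fun u => ?_⟩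
  have hC : ∀ m ∈ f.coeff.support, |Real.log ‖f.coeff m‖|
      ≤ ∑ m ∈ f.coeff.support, |Real.log ‖f.coeff m‖| := fun m hm =>
    Finset.single_le_sum (f := fun m => |Real.log ‖f.coeff m‖|) (fun _ _ => abs_nonneg _) hm
  obtain ⟨-, ⟨m, hm, hm'⟩, hle⟩ := isLeast_supportFunction hf u
  obtain ⟨l, hl, hl'⟩ := exists_neg_log_gaussNorm_eq hf u
  rw [ronkin_of_nonarch]
  simp only
  have e1 := neg_log_gaussNorm_le hm u
  have e2 := hle l hl
  have e3 := abs_le.1 (hC m hm)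
  have e4 := abs_le.1 (hC l hl)
  simp only [monomialOrder] at e1 hl'
  rw [abs_le]
  constructor <;> linarith

end NonArch

end Ronkin

theorem proposition2p6 {K : Type*} [NormedField K] [CompleteSpace K] [IsAlgClosed K]
    {M : Type*} [AddCommGroup M] [Module.Free ℤ M] [Module.Finite ℤ M]
    (f : AddMonoidAlgebra K M) (hf : f ≠ 0) :
    -- the integral that defines the Ronkin function is finite
    (∀ u : Ronkin.NR M,
      (∀ᵐ x ∂(Ronkin.fibreMeasure (K := K) u), x f ≠ 0) ∧
      IntegrableOn (fun x : Ronkin.TorusAn K M => -Real.log (x f)) (Ronkin.trop ⁻¹' {u})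
        (Ronkin.fibreMeasure u)) ∧
    -- continuity and concavity
    (Continuous (Ronkin.ronkin f) ∧ ConcaveOn ℝ Set.univ (Ronkin.ronkin f) ∧
      UpperSemicontinuous (Ronkin.ronkin f)) ∧
    -- affine on the connected components of the complement of the amoeba
    (∀ u ∈ (Ronkin.amoeba f)ᶜ, ∃ g : Ronkin.NR M →ᵃ[ℝ] ℝ,
      Set.EqOn (Ronkin.ronkin f) g (connectedComponentIn (Ronkin.amoeba f)ᶜ u)) ∧
    -- bounded distance to the support function of the Newton polytope
    (∃ C : ℝ, ∀ u : Ronkin.NR M,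
      |Ronkin.ronkin f u - Ronkin.supportFunction (Ronkin.newtonPolytope f) u| ≤ C) ∧
    -- stability set and recession function
    Ronkin.stabilitySet (Ronkin.ronkin f) = Ronkin.newtonPolytope f ∧
    Ronkin.IsRecessionFunction (Ronkin.ronkin f)
      (Ronkin.supportFunction (Ronkin.newtonPolytope f)) := by
  have hbounded : ∃ C : ℝ, ∀ u : Ronkin.NR M,
      |Ronkin.ronkin f u - Ronkin.supportFunction (Ronkin.newtonPolytope f) u| ≤ C := by
    by_cases h : IsUltrametricDist K
    · exact Ronkin.bounded_of_nonarch hf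
    · exact Ronkin.bounded_of_arch h hf
  have hcont : Continuous (Ronkin.ronkin f) := by
    by_cases h : IsUltrametricDist K
    · exact Ronkin.continuous_ronkin_of_nonarch hf
    · exact Ronkin.continuous_ronkin_of_arch h hf
  obtain ⟨C, hC⟩ := hbounded
  refine ⟨fun u => ?_, ⟨hcont, ?_, hcont.upperSemicontinuous⟩, fun u hu => ?_, ⟨C, hC⟩,
    Ronkin.stabilitySet_of_bounded hf hC, Ronkin.isRecessionFunction_of_bounded hf hC⟩
  · by_cases h : IsUltrametricDist K
    · exact ⟨Ronkin.ae_ne_zero_of_nonarch hf u, Ronkin.integrableOn_of_nonarch f u⟩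
    · exact ⟨Ronkin.ae_ne_zero_of_arch h hf u, Ronkin.integrableOn_of_arch h hf u⟩
  · by_cases h : IsUltrametricDist K
    · exact Ronkin.concaveOn_ronkin_of_nonarch hf
    · exact Ronkin.concaveOn_ronkin_of_arch h hf
  · by_cases h : IsUltrametricDist K
    · exact Ronkin.exists_affineMap_of_nonarch hf isPreconnected_connectedComponentIn
        (connectedComponentIn_subset _ _)
    · exact Ronkin.exists_affineMap_of_arch h hf isPreconnected_connectedComponentIn
        (connectedComponentIn_subset _ _)
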